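/- Let $K$ be a closed oriented quasi-simplicial complex of dimension $3$, obtained from tetrahedra $T_1,\dots,T_N$ with ordered vertices by gluing their faces in pairs by orientation-reversing simplicial maps, the orderings being compatible with the orientation (for each even ordering $(i,j,k,l)$ of the vertices of a tetrahedron, the face $ijk$ is oriented as part of its boundary). Assume that $|K|$ minus the vertices is a manifold and that the link of each vertex is a torus. Let $\partial M$ be the disjoint union of the links, each oriented as the boundary of the cone neighbourhood of its vertex and triangulated by the traces of the tetrahedra. Below, $(i,j,k,l)$ always denotes an even ordering of the vertices of a tetrahedron $T_\mu$. *Cells.* Let $\mathcal D$ be the cell decomposition of $\partial M$ whose edges are the arcs $c_{ij}^\mu$: in the triangle cut by $T_\mu$ in the link of $i$, the arc $c_{ij}^\mu$ joins the midpoint of the side on the face $ijk$ to the midpoint of the side on the face $ijl$, turning left around the corner on the edge $ij$. Let $\mathcal D'$ be the dual decomposition, with edges $(c_{ij}^\mu)'$ from the vertex of the triangle on the edge $ij$ to the centre of the triangle; the intersection numbers are $\iota(c_x,c_y')=\delta_{xy}$. *Coefficients.* Let $L=\mathbb Z^2$ with the form $[(n,m),(n',m')]=2nn'-nm'-mn'+2mm'$,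 let $L'=\{y\in L\otimes\mathbb R:[x,y]\in\mathbb Z\ \forall x\in L\}\supseteq L$ be the dual lattice (identified with $\operatorname{Hom}(L,\mathbb Z)$ by $y\mapsto[\cdot,y]$), and let $\omega=\iota\otimes[\,,\,]:C_1(\mathcal D,L)\times C_1(\mathcal D',L')\to\mathbb Z$. *Coordinates.* Let $J^2$ be the free $\mathbb Z$-module on the oriented edges $e_{ij}^\mu$ and the faces $e_{ijk}^\mu$ of all the tetrahedra. Let $\Omega^2$ be the skew-symmetric form on $J^2$, orthogonal sum over the tetrahedra, with $\Omega^2(e_\alpha,e_\beta)=\#\{\text{arrows }\alpha\to\beta\}-\#\{\text{arrows }\beta\to\alpha\}$, where the arrows are $ij\to ik$, $ijk\to ij$ and $ik\to ijk$ for each even $(i,j,k,l)$. Let $p:J^2\to(J^2)^*$, $p(v)=\Omega^2(v,\cdot)$. Let $F:C_1^{\rm or}+C_2\to J^2$, on the free module on the oriented edges and the (unoriented) $2$-faces of $K$, send an oriented edge of $K$ to the sum of all the $e_{ij}^\mu$ identified with it and a face to the sum of its two copies. Put $$\mathcal H(J)=\operatorname{Ker}(F^*\circ p)\,/\,(\operatorname{Im}F+\operatorname{Ker}p).$$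 *Maps.* Let $h:C_1(\mathcal D,L)\to J^2$ be the linear map with $$h(c_{ij}^\mu\otimes(n,m))=2m\,e_{ij}^\mu+2n\,e_{ji}^\mu+n\,(e_{ijk}^\mu+e_{ilj}^\mu),$$ and let $g:J^2\to C_1(\mathcal D',L')$ be $h^*\circ p$ followed by the identification of $C_1(\mathcal D,L)^*$ with $C_1(\mathcal D',L')$ by $\omega$; so $\omega(c,g(e))=\Omega^2(e,h(c))$. **Theorem.** The maps $h$ and $g$ induce linear maps $$\bar h:H_1(\partial M,L)=H_1(\mathcal D,L)\to\mathcal H(J),\qquad \bar g:\mathcal H(J)\to H_1(\mathcal D',L')=H_1(\partial M,L'),$$ and $\omega$, $\Omega^2$ induce bilinear forms $\omega$ on $H_1(\mathcal D,L)\times H_1(\mathcal D',L')$ and $\Omega$ on $\mathcal H(J)$. There is a canonical isomorphism $\kappa:H_1(\mathcal D,L)\cong H_1(\mathcal D',L)$ (cycles correspond if and only if they are homologous in the common subdivision of $\mathcal D$ and $\mathcal D'$). With it and the map $H_1(\mathcal D',L)\to H_1(\mathcal D',L')$ induced by the inclusion $L\subseteq L'$: 1. $\bar g\circ\bar h$ is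 multiplication by $4$, that is, $\bar g(\bar h(c))$ is $4$ times the image of $\kappa(c)$ in $H_1(\mathcal D',L')$, for every $c\in H_1(\partial M,L)$. 2. $\omega(c,\bar g(e))=\Omega(e,\bar h(c))$ for all $e\in\mathcal H(J)$ and $c\in H_1(\partial M,L)$. -/

import Mathlib

noncomputable section

namespace FlagComplex

open Equiv

/-! ### Subquotients and induced maps -/

/-- The subquotient `Z / (B ∩ Z)` of a module, for submodules `Z`, `B`
(in every use below `B ≤ Z`, so this is `Z / B`). -/
abbrev Subquot {M : Type*} [AddCommGroup M] (Z B : Submodule ℤ M) : Type _ :=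
  ↥Z ⧸ B.submoduleOf Z

/-- The class of an element of `Z` in `Z / (B ∩ Z)`. -/
def cls {M : Type*} [AddCommGroup M] (Z B : Submodule ℤ M) (z : Z) : Subquot Z B :=
  Submodule.Quotient.mk z

/-- `f` maps `Z` into `Z'`, and `fbar` is the map `[z] ↦ [f z]` it induces on subquotients. -/
def Induces {M M' : Type*} [AddCommGroup M] [AddCommGroup M']
    {Z B : Submodule ℤ M} {Z' B' : Submodule ℤ M'}
    (f : M →ₗ[ℤ] M') (fbar : Subquot Z B →ₗ[ℤ] Subquot Z' B') : Prop :=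
  ∀ z : Z, ∃ hz : f z ∈ Z', fbar (cls Z B z) = cls Z' B' ⟨f z, hz⟩

/-- `βbar` is the pairing `([z], [z']) ↦ β z z'` which `β` induces on subquotients. -/
def InducesForm {M M' : Type*} [AddCommGroup M] [AddCommGroup M']
    {Z B : Submodule ℤ M} {Z' B' : Submodule ℤ M'}
    (β : M →ₗ[ℤ] M' →ₗ[ℤ] ℤ) (βbar : Subquot Z B →ₗ[ℤ] Subquot Z' B' →ₗ[ℤ] ℤ) : Prop :=
  ∀ (z : Z) (z' : Z'), βbar (cls Z B z) (cls Z' B' z') = β z z'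

/-! ### Two-dimensional cell complexes and their first homology -/

/-- The combinatorial data of a cell complex of dimension at most two: its cells, the initial and
the final vertex of each oriented edge, and the boundary of each oriented face. -/
structure CellComplex where
  Vertex : Type
  Edge : Type
  Face : Type
  src : Edge → Vertex
  tgt : Edge → Vertex
  bdry : Face → (Edge →₀ ℤ)

namespace CellComplex

variable (D : CellComplex) (A : Type) [AddCommGroup A]

/-- `C₁(D, A)`; the chain `e ⊗ a` is `Finsupp.single e a`. -/
abbrev C₁ : Type := D.Edge →₀ A

/-- `∂ (e ⊗ a) = tgt e ⊗ a - src e ⊗ a`. -/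
def d₁ : (D.Edge →₀ A) →ₗ[ℤ] (D.Vertex →₀ A) :=
  Finsupp.lmapDomain A ℤ D.tgt - Finsupp.lmapDomain A ℤ D.src

/-- `∂ (f ⊗ a) = bdry f ⊗ a`. -/
def d₂ : (D.Face →₀ A) →ₗ[ℤ] (D.Edge →₀ A) :=
  Finsupp.lsum ℤ fun f => (D.bdry f).sum fun e n => n • (Finsupp.lsingle e : A →ₗ[ℤ] D.Edge →₀ A)

/-- The group of `1`-cycles. -/
def Z₁ : Submodule ℤ (D.Edge →₀ A) := LinearMap.ker (D.d₁ A)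

/-- The group of `1`-boundaries. -/
def B₁ : Submodule ℤ (D.Edge →₀ A) := LinearMap.range (D.d₂ A)

/-- The first cellular homology group `H₁(D, A)`. -/
abbrev H₁ : Type := Subquot (D.Z₁ A) (D.B₁ A)

end CellComplex

/-! ### The coefficient lattices -/

/-- The root lattice `L` of `𝔰𝔩(3)`, in the basis `(1, -1, 0)`, `(0, 1, -1)`. -/
abbrev L : Type := ℤ × ℤ

/-- The form `[ , ]` on `L`, the restriction of the euclidean product of `ℝ³`. -/
def killing : L →ₗ[ℤ] L →ₗ[ℤ] ℤ :=
  LinearMap.mk₂ ℤ (fun x y => 2 * x.1 * y.1 - x.1 * y.2 - x.2 * y.1 + 2 * x.2 * y.2)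
    (by intro a b c; simp; ring) (by intro a b c; simp; ring)
    (by intro a b c; simp; ring) (by intro a b c; simp; ring)

/-- The dual lattice `L' = {y ∈ V : [x, y] ∈ ℤ for all x ∈ L}`, where `V = L ⊗ ℝ`. It is identified
with `L^* = Hom(L, ℤ)` by `y ↦ [·, y]`; so for `φ ∈ L'` and `l ∈ L` the product `[l, φ]` is `φ l`,
and the inclusion `L ⊆ L'` is the map `l ↦ [·, l]`, which is `killing`. -/
abbrev L' : Type := Module.Dual ℤ L

/-! ### Closed oriented tetrahedra complexes -/

/-- An even ordering `(i, j, k, l)` of the vertices of a tetrahedron: `σ 0 = i`, `σ 1 = j`,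
`σ 2 = k`, `σ 3 = l`. It is determined by the ordered pair `(i, j)`, so that even orderings are the
same thing as oriented edges `ij` of the tetrahedron. -/
abbrev EvenOrd : Type := alternatingGroup (Fin 4)

/-- `(i, j, k, l) ↦ (j, i, l, k)`. -/
def EvenOrd.rev (σ : EvenOrd) : EvenOrd :=
  σ * ⟨swap 0 1 * swap 2 3, by rw [Perm.mem_alternatingGroup]; decide⟩

/-- `(i, j, k, l) ↦ (i, k, l, j)`. -/
def EvenOrd.fwd (σ : EvenOrd) : EvenOrd :=
  σ * ⟨swap 1 2 * swap 2 3, by rw [Perm.mem_alternatingGroup]; decide⟩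

/-- `(i, j, k, l) ↦ (i, l, j, k)`. -/
def EvenOrd.bwd (σ : EvenOrd) : EvenOrd :=
  σ * ⟨swap 2 3 * swap 1 2, by rw [Perm.mem_alternatingGroup]; decide⟩

/-- A closed oriented quasi-simplicial complex of dimension three, made of `N` tetrahedra with
ordered vertices by gluing all their faces in pairs. The face of the tetrahedron `t` opposite to its
vertex `f` is glued to the face of the tetrahedron `nbr t f` opposite to its vertex `glue t f f`;
the three vertices `i ≠ f` of the face are glued to the vertices `glue t f i`. The orderings of the
vertices are compatible with the orientation: the gluings reverse orientation. -/
structure Complex (N : ℕ) where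
  nbr : Fin N → Fin 4 → Fin N
  glue : Fin N → Fin 4 → Perm (Fin 4)
  nbr_nbr : ∀ t f, nbr (nbr t f) (glue t f f) = t
  glue_glue : ∀ t f, glue (nbr t f) (glue t f f) = (glue t f)⁻¹
  not_self : ∀ t f, (nbr t f, glue t f f) ≠ (t, f)
  sign_glue : ∀ t f, Perm.sign (glue t f) = -1

/-- The oriented edges `ij` of the `N` tetrahedra. The same pairs index the corners of the
triangulation of the vertex links: the tetrahedron `t` cuts the link of its vertex `i` in a triangle
`(t, i)`, which has one corner on each edge `ij`. -/
abbrev Corner (N : ℕ) : Type := Fin N × EvenOrd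

namespace Corner

variable {N : ℕ}

/-- The edge `ji`. -/
def rev (x : Corner N) : Corner N := (x.1, x.2.rev)

/-- The corner at `il` of the same triangle, where `(i, j, k, l)` is even. -/
def bwd (x : Corner N) : Corner N := (x.1, x.2.bwd)

/-- The triangle of the link which contains the corner. -/
def tri (x : Corner N) : Fin N × Fin 4 := (x.1, x.2.1 0)

end Corner

namespace Complex

variable {N : ℕ} (K : Complex N)

/-- The corner `ij` of the tetrahedron which is glued to the given one along the face `ijl`, where
`(i, j, k, l)` is even: the next corner around the same oriented edge of `K`. -/
def next (x : Corner N) : Corner N :=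
  (K.nbr x.1 (x.2.1 2), ⟨K.glue x.1 (x.2.1 2) * x.2.1 * swap 2 3, by
    rw [Perm.mem_alternatingGroup, Perm.sign_mul, Perm.sign_mul, K.sign_glue,
      Perm.mem_alternatingGroup.1 x.2.2, Perm.sign_swap (by decide)]; rfl⟩)

/-- An even ordering `(i, j, k, l)` also names the side of the triangle `(t, i)` on the face `ijk`
(it depends on `i` and `l` only). This is the same side, seen in the tetrahedron
which is glued to `t` along the face `ijk`. -/
def flip (x : Corner N) : Corner N :=
  (K.nbr x.1 (x.2.1 3), ⟨K.glue x.1 (x.2.1 3) * x.2.1 * swap 1 2, by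
    rw [Perm.mem_alternatingGroup, Perm.sign_mul, Perm.sign_mul, K.sign_glue,
      Perm.mem_alternatingGroup.1 x.2.2, Perm.sign_swap (by decide)]; rfl⟩)

/-- The oriented edges of `K`; also the vertices of the triangulated vertex links, the edge oriented
from `j` to `i` being a vertex of the link of `i`. -/
def OrEdge : Type := Quot fun x y : Corner N => y = K.next x

/-- The class in `K` of the oriented edge `ij` of a tetrahedron. -/
def orEdge (x : Corner N) : K.OrEdge := Quot.mk _ x

/-- The two-dimensional faces of `K`; `(t, f)` is the face of `t` opposite to the vertex `f`. -/
def Face : Type := Quot fun a b : Fin N × Fin 4 => b = (K.nbr a.1 a.2, K.glue a.1 a.2 a.2)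

/-- The class in `K` of a face of a tetrahedron. -/
def face (a : Fin N × Fin 4) : K.Face := Quot.mk _ a

/-- The edges of the triangulated vertex links. -/
def Side : Type := Quot fun x y : Corner N => y = K.flip x

/-- The side on the face `ijk` of the triangle `(t, i)`, for `(i, j, k, l)` even. -/
def side (x : Corner N) : K.Side := Quot.mk _ x

/-- The vertices of `K`; `(t, i)` is the vertex `i` of `t`. -/
def Vertex : Type :=
  Quot fun a b : Fin N × Fin 4 => ∃ f, f ≠ a.2 ∧ b = (K.nbr a.1 f, K.glue a.1 f a.2)

/-- The class in `K` of a vertex of a tetrahedron. -/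
def vertex (a : Fin N × Fin 4) : K.Vertex := Quot.mk _ a

/-- No edge is glued to itself with reversed orientation. Equivalently, `|K|` minus the vertices is
a manifold. -/
def IsManifold : Prop := ∀ x : Corner N, K.orEdge x ≠ K.orEdge x.rev

/-- The Euler characteristic of the link of `v`, from the numbers of vertices, edges and triangles
of its triangulation. -/
def linkEuler (v : K.Vertex) : ℤ :=
  ((K.orEdge '' {x | K.vertex x.tri = v}).ncard : ℤ) - (K.side '' {x | K.vertex x.tri = v}).ncard
    + {a | K.vertex a = v}.ncard

/-- Each vertex link is a torus: it is by construction a closed connected oriented surface,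
so this says that its Euler characteristic vanishes. -/
def LinksAreTori : Prop := ∀ v : K.Vertex, K.linkEuler v = 0

/-! ### The cell decompositions of the vertex links -/

open Classical in
/-- The cell decomposition `𝒟` of `∂M`, the union of the vertex links. Its vertices are the
midpoints of the sides of the triangles. Its edges `c_ij` cut the corners: for `(i, j, k, l)` even,
`c_ij` turns left around `ij`, from the face `ijk` to the face `ijl`. Its faces are the inner
triangles and the polygons around the vertices of the triangulation. -/
abbrev D : CellComplex where
  Vertex := K.Side
  Edge := Corner N
  Face := (Fin N × Fin 4) ⊕ K.OrEdge
  src x := K.side x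
  tgt x := K.side x.bwd
  bdry
    | Sum.inl a => ∑ x : Corner N with x.tri = a, Finsupp.single x 1
    | Sum.inr v => ∑ x : Corner N with K.orEdge x = v, Finsupp.single x 1

open Classical in
/-- The dual cell decomposition `𝒟'`. Its vertices are the vertices and the centres of the triangles
of the link, and its edge `c'_ij`, dual to `c_ij`, goes from the vertex on the edge `ij` to the
centre of the triangle. Its faces are the quadrilaterals around the sides of the triangles.

Each link is oriented as the boundary of the cone neighbourhood of the vertex of `K`, where `K` is
oriented so that the face `ijk`, seen from outside the tetrahedron, is counterclockwise
when `(i, j, k, l)` is even. Then `c_ij` and `c'_ij` have intersection number `1`. -/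
abbrev D' : CellComplex where
  Vertex := K.OrEdge ⊕ (Fin N × Fin 4)
  Edge := Corner N
  Face := K.Side
  src x := Sum.inl (K.orEdge x)
  tgt x := Sum.inr x.tri
  bdry s := ∑ x : Corner N with K.side x.bwd = s, Finsupp.single x 1
    - ∑ x : Corner N with K.side x = s, Finsupp.single x 1

/-- The vertices of the common subdivision of `𝒟` and `𝒟'`: those of `𝒟`, those of `𝒟'`, and the
points where `c_ij` crosses `c'_ij`. -/
inductive OverlayVertex (K : Complex N) : Type
  | mid (s : K.Side)
  | vert (v : K.OrEdge)
  | ctr (a : Fin N × Fin 4)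
  | cross (x : Corner N)

/-- The edges of the common subdivision: `c_ij` is `first` followed by `second`,
and `c'_ij` is `outer` followed by `inner`. -/
inductive OverlayEdge (N : ℕ) : Type
  | first (x : Corner N)
  | second (x : Corner N)
  | outer (x : Corner N)
  | inner (x : Corner N)

/-- The faces of the common subdivision: for each corner, with final midpoint `m` of `c_ij`,
the quadrilateral at `m` between `c_ij` and the next corner around the same vertex, and
the quadrilateral at `m` between `c_ij` and the other corner on the side of `m` in the triangle. -/
inductive OverlayFace (N : ℕ) : Type
  | outer (x : Corner N)
  | inner (x : Corner N)

open OverlayVertex in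
/-- The common subdivision of the cell decompositions `𝒟` and `𝒟'` of the vertex links. -/
abbrev overlay : CellComplex where
  Vertex := K.OverlayVertex
  Edge := OverlayEdge N
  Face := OverlayFace N
  src
    | .first x => mid (K.side x)
    | .second x => cross x
    | .outer x => vert (K.orEdge x)
    | .inner x => cross x
  tgt
    | .first x => cross x
    | .second x => mid (K.side x.bwd)
    | .outer x => cross x
    | .inner x => ctr x.tri
  bdry
    | OverlayFace.outer x => Finsupp.single (.outer x) 1 + Finsupp.single (.second x) 1
        + Finsupp.single (.first (K.next x)) 1 - Finsupp.single (.outer (K.next x)) 1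
    | OverlayFace.inner x => Finsupp.single (.second x) 1 + Finsupp.single (.first x.bwd) 1
        + Finsupp.single (.inner x.bwd) 1 - Finsupp.single (.inner x) 1

/-- Subdivision of chains `C₁(𝒟, A) → C₁(overlay, A)`. -/
def sd (A : Type) [AddCommGroup A] : K.D.C₁ A →ₗ[ℤ] K.overlay.C₁ A :=
  Finsupp.lmapDomain A ℤ (fun x : Corner N => OverlayEdge.first x) + Finsupp.lmapDomain A ℤ (fun x : Corner N => OverlayEdge.second x)

/-- Subdivision of chains `C₁(𝒟', A) → C₁(overlay, A)`. -/
def sd' (A : Type) [AddCommGroup A] : K.D'.C₁ A →ₗ[ℤ] K.overlay.C₁ A :=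
  Finsupp.lmapDomain A ℤ (fun x : Corner N => OverlayEdge.outer x) + Finsupp.lmapDomain A ℤ (fun x : Corner N => OverlayEdge.inner x)

/-- `κ` is the canonical isomorphism `H₁(𝒟, A) ≃ H₁(𝒟', A)` (both are `H₁(∂M, A)`): the classes of
two cycles correspond if and only if the cycles are homologous in the common subdivision. -/
def IsCanonical {A : Type} [AddCommGroup A] (κ : K.D.H₁ A ≃ₗ[ℤ] K.D'.H₁ A) : Prop :=
  ∀ (z : K.D.Z₁ A) (z' : K.D'.Z₁ A),
    κ (cls _ _ z) = cls _ _ z' ↔ K.sd A z - K.sd' A z' ∈ K.overlay.B₁ A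

/-- The pairing `ω = ι ⊗ [ , ]` on `C₁(𝒟, L) × C₁(𝒟', L')`, where `ι` is the intersection number:
`ω (c_x ⊗ l, c'_y ⊗ φ)` is `[l, φ]` if `x = y` and `0` otherwise. -/
def ω : K.D.C₁ L →ₗ[ℤ] K.D'.C₁ L' →ₗ[ℤ] ℤ :=
  Finsupp.lsum ℤ fun x : Corner N =>
    (Finsupp.lapply x : (Corner N →₀ L') →ₗ[ℤ] L').dualMap ∘ₗ Module.Dual.eval ℤ L

end Complex

/-! ### The module of coordinates of a tetrahedron -/

/-- The index set of the coordinates of a tetrahedron: the oriented edges `ij`, and the faces `ijk`,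
named by the opposite vertex `l`. -/
inductive Coord : Type
  | edge (σ : EvenOrd)
  | face (l : Fin 4)

/-- The number of arrows from one coordinate to another. For each even ordering `(i, j, k, l)`
there are on the face `ijk` the arrows `ij → ik`, `ijk → ij` and `ik → ijk`. -/
def arrows : Coord → Coord → ℤ
  | .edge σ, .edge τ => if τ = σ.fwd then 1 else 0
  | .face f, .edge σ => if f = σ.1 3 then 1 else 0
  | .edge σ, .face f => if f = σ.1 2 then 1 else 0
  | .face _, .face _ => 0

/-- The skew-symmetric matrix `ε`. -/
def ε (α β : Coord) : ℤ := arrows α β - arrows β α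

/-- The free module `J²` on the coordinates of the `N` tetrahedra. -/
abbrev J2 (N : ℕ) : Type := (Fin N × Coord) →₀ ℤ

/-- The basis element `e_ij` of `J²`. -/
def eEdge {N : ℕ} (x : Corner N) : J2 N := Finsupp.single (x.1, .edge x.2) 1

/-- The basis element of `J²` for the face of `t` opposite to the vertex `f`. -/
def eFace {N : ℕ} (a : Fin N × Fin 4) : J2 N := Finsupp.single (a.1, .face a.2) 1

/-- The form `Ω²` on `J²`, the orthogonal sum of the forms with matrix `ε` of the tetrahedra.
As a map from `J²` to its dual it is the map `p`. -/
def Ω2 (N : ℕ) : J2 N →ₗ[ℤ] J2 N →ₗ[ℤ] ℤ :=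
  Finsupp.linearCombination ℤ fun a =>
    Finsupp.linearCombination ℤ fun b => if a.1 = b.1 then ε a.2 b.2 else 0

namespace Complex

variable {N : ℕ} (K : Complex N)

open Classical in
/-- The map `F : C₁^or + C₂ → J²`, which sends an oriented edge of `K` to the sum of the `e_ij` of
the tetrahedra around it, and a face to the sum of its two copies. -/
def F : ((K.OrEdge ⊕ K.Face) →₀ ℤ) →ₗ[ℤ] J2 N :=
  Finsupp.linearCombination ℤ fun
    | Sum.inl v => ∑ x : Corner N with K.orEdge x = v, eEdge x
    | Sum.inr s => ∑ a : Fin N × Fin 4 with K.face a = s, eFace a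

/-- `Ker (F^* ∘ p)`, where `F^*` is the dual of `F`. -/
def kerFp : Submodule ℤ (J2 N) := LinearMap.ker (K.F.dualMap ∘ₗ Ω2 N)

/-- `Im F + Ker p`. -/
def imF : Submodule ℤ (J2 N) := LinearMap.range K.F ⊔ LinearMap.ker (Ω2 N)

/-- The homology group `𝓗(J) = Ker (F^* ∘ p) / (Im F + Ker p)`. -/
abbrev HJ : Type := Subquot K.kerFp K.imF

/-- The linearized holonomy `h : C₁(𝒟, L) → J²`,
`h (c_ij ⊗ (n, m)) = 2 m e_ij + 2 n e_ji + n (e_ijk + e_ilj)` for `(i, j, k, l)` even. -/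
def h : K.D.C₁ L →ₗ[ℤ] J2 N :=
  Finsupp.lsum ℤ fun x : Corner N =>
    (LinearMap.snd ℤ ℤ ℤ).smulRight (2 • eEdge x)
    + (LinearMap.fst ℤ ℤ ℤ).smulRight
        (2 • eEdge x.rev + eFace (x.1, x.2.1 3) + eFace (x.1, x.2.1 2))

/-- The map `g : J² → C₁(𝒟', L')`: it is `h^* ∘ p`, followed by the identification of the dual of
`C₁(𝒟, L)` with `C₁(𝒟', L')` by `ω`, which sends a linear form `λ` to
the sum over the corners `x` of `c'_x ⊗ (l ↦ λ (c_x ⊗ l))`. -/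
def g : J2 N →ₗ[ℤ] K.D'.C₁ L' :=
  (∑ x : Corner N, (Finsupp.lsingle x : L' →ₗ[ℤ] (Corner N →₀ L')) ∘ₗ
    (Finsupp.lsingle x : L →ₗ[ℤ] (Corner N →₀ L)).dualMap) ∘ₗ K.h.dualMap ∘ₗ Ω2 N

end Complex

end FlagComplex

end

noncomputable section

namespace FlagComplex

open Equiv

/-! ### Maps and forms on subquotients -/

section Subquotients

variable {M M' P : Type*} [AddCommGroup M] [AddCommGroup M'] [AddCommGroup P]
  {Z B : Submodule ℤ M} {Z' B' : Submodule ℤ M'}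

/-! For a chain z of 𝒟, the values of Ω²(h z) on the basis of J² (`Ω2_h_eEdge`, `Ω2_h_eFace`)
involve only differences of z between corners of one triangle. Hence an inner triangle goes to Ker
p. A polygon around a vertex of a link goes to Im F, because the faces around an edge of K occur in
glued pairs (`h_polygon_mem`). So h sends boundaries into Im F + Ker p. Against F of an edge or a
face of K, the differences combine in glued pairs into coefficients of ∂z: Ω²(h z, F b) is a linear
function of ∂z (`exists_Ω2_h_F`), and h sends cycles into Ker(F^* ∘ p).

The claims on g follow by adjunction. The identity ω(c, g e) = Ω²(e, h c) holds on chains (`ω_g`)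
and gives assertion 2. Since the cycles of 𝒟' are the chains ω-orthogonal to the boundaries of 𝒟
(`mem_Z₁_D'_iff_ω`), g sends Ker(F^* ∘ p) to cycles, and `exists_Ω2_h_F` read backwards makes g(F b)
a boundary.

For assertion 1, `g_h_apply` computes g(h z). The contributions from the links of the other vertices
of the tetrahedron are differences of `sideSum`; for a cycle this is a function of the sides
(`sideSum_flip`), so they form a boundary. The rest is twice the chain x ↦ z(x.bwd) - z(x.fwd),
which replaces each arc c_ij by the path from the vertex on ik through the centre to the vertex on
il. As c_ij is the midline parallel to this path, the chain should be twice z; it does differ from 2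
z' by a boundary when z' is homologous to z (`g_h_sub_mem_B₁`). Hence the factor 4.

The isomorphism κ compares both homologies inside chains modulo boundaries of the common
subdivision. All such comparisons reduce to the four equations of `sd_sub_sd'_mem_B₁_iff` for the
coefficients p and q of the outer and inner quadrilaterals. -/

theorem cls_surjective (a : Subquot Z B) : ∃ z, cls Z B z = a :=
  Submodule.Quotient.mk_surjective _ a

theorem cls_eq_smul_cls (n : ℤ) (z w : Z) (h : (z : M) - n • (w : M) ∈ B) :
    cls Z B z = n • cls Z B w :=
  (Submodule.Quotient.eq _).2 h

theorem exists_induces (f : M →ₗ[ℤ] M') (hZ : ∀ z ∈ Z, f z ∈ Z')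
    (hB : ∀ b ∈ B, f b ∈ B') :
    ∃ fbar : Subquot Z B →ₗ[ℤ] Subquot Z' B', Induces f fbar :=
  ⟨Submodule.mapQ _ _ (f.restrict hZ) fun _ hb => hB _ hb, fun z => ⟨hZ z z.2, rfl⟩⟩

theorem exists_inducesForm (β : M →ₗ[ℤ] M' →ₗ[ℤ] ℤ) (hl : ∀ b ∈ B, ∀ z' ∈ Z', β b z' = 0)
    (hr : ∀ z ∈ Z, ∀ b' ∈ B', β z b' = 0) :
    ∃ βbar : Subquot Z B →ₗ[ℤ] Subquot Z' B' →ₗ[ℤ] ℤ, InducesForm β βbar := by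
  let γ : Z →ₗ[ℤ] Z' →ₗ[ℤ] ℤ := β.compl₁₂ Z.subtype Z'.subtype
  let γ' : Z →ₗ[ℤ] (Subquot Z' B' →ₗ[ℤ] ℤ) :=
    { toFun := fun z => Submodule.liftQ _ (γ z) fun b hb => hr z z.2 _ hb
      map_add' := fun x y => by
        ext a; exact LinearMap.congr_fun (map_add γ x y) a
      map_smul' := fun c x => by
        ext a; exact LinearMap.congr_fun (map_smul γ c x) a }
  refine ⟨Submodule.liftQ _ γ' fun b hb => ?_, fun z z' => rfl⟩
  ext a
  exact hl b hb _ a.2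

/-- Two subquotients which map injectively to a third one, with the same image, are isomorphic. -/
theorem exists_equiv_of_comparison {BP : Submodule ℤ P} (f : M →ₗ[ℤ] P) (f' : M' →ₗ[ℤ] P)
    (hf : ∀ z ∈ Z, f z ∈ BP ↔ z ∈ B) (hf' : ∀ z ∈ Z', f' z ∈ BP ↔ z ∈ B')
    (hs : ∀ z ∈ Z, ∃ z' ∈ Z', f z - f' z' ∈ BP) (hs' : ∀ z' ∈ Z', ∃ z ∈ Z, f z - f' z' ∈ BP) :
    ∃ κ : Subquot Z B ≃ₗ[ℤ] Subquot Z' B', ∀ (z : Z) (z' : Z'),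
      κ (cls Z B z) = cls Z' B' z' ↔ f z - f' z' ∈ BP := by
  let φ : Subquot Z B →ₗ[ℤ] P ⧸ BP := Submodule.liftQ _ (BP.mkQ ∘ₗ f ∘ₗ Z.subtype) fun b hb => by
    simpa using (hf b b.2).2 hb
  let φ' : Subquot Z' B' →ₗ[ℤ] P ⧸ BP :=
    Submodule.liftQ _ (BP.mkQ ∘ₗ f' ∘ₗ Z'.subtype) fun b hb => by
      simpa using (hf' b b.2).2 hb
  have hφ : ∀ z, φ (cls Z B z) = BP.mkQ (f z) := fun z => rfl
  have hφ' : ∀ z, φ' (cls Z' B' z) = BP.mkQ (f' z) := fun z => rfl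
  have inj : Function.Injective φ := by
    rw [← LinearMap.ker_eq_bot, LinearMap.ker_eq_bot']
    intro a ha
    obtain ⟨z, rfl⟩ := cls_surjective a
    rw [hφ, Submodule.mkQ_apply, Submodule.Quotient.mk_eq_zero, hf z z.2] at ha
    exact (Submodule.Quotient.mk_eq_zero _).2 ha
  have inj' : Function.Injective φ' := by
    rw [← LinearMap.ker_eq_bot, LinearMap.ker_eq_bot']
    intro a ha
    obtain ⟨z, rfl⟩ := cls_surjective a
    rw [hφ', Submodule.mkQ_apply, Submodule.Quotient.mk_eq_zero, hf' z z.2] at ha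
    exact (Submodule.Quotient.mk_eq_zero _).2 ha
  have range_eq : LinearMap.range φ = LinearMap.range φ' := by
    apply le_antisymm
    · rintro _ ⟨a, rfl⟩
      obtain ⟨z, rfl⟩ := cls_surjective a
      obtain ⟨z', hz', h⟩ := hs z z.2
      refine ⟨cls _ _ ⟨z', hz'⟩, ?_⟩
      rw [hφ, hφ', eq_comm]
      exact (Submodule.Quotient.eq _).2 h
    · rintro _ ⟨a, rfl⟩
      obtain ⟨z', rfl⟩ := cls_surjective a
      obtain ⟨z, hz, h⟩ := hs' z' z'.2
      refine ⟨cls _ _ ⟨z, hz⟩, ?_⟩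
      rw [hφ, hφ']
      exact (Submodule.Quotient.eq _).2 h
  refine ⟨LinearEquiv.ofInjective φ inj ≪≫ₗ LinearEquiv.ofEq _ _ range_eq ≪≫ₗ
    (LinearEquiv.ofInjective φ' inj').symm, fun z z' => ?_⟩
  rw [LinearEquiv.trans_apply, LinearEquiv.trans_apply, LinearEquiv.symm_apply_eq,
    ← Submodule.Quotient.eq, Subtype.ext_iff]
  rfl

end Subquotients

/-! ### Finitely supported functions and quotients -/

theorem quot_mk_eq_iff_of_involutive {α : Type*} {ι : α → α} (hι : Function.Involutive ι)
    (x y : α) : Quot.mk (fun a b => b = ι a) x = Quot.mk _ y ↔ y = x ∨ y = ι x := by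
  constructor
  · intro h
    rw [Quot.eq] at h
    induction h with
    | rel a b h => exact Or.inr h
    | refl a => exact Or.inl rfl
    | symm a b _ ih => rcases ih with rfl | rfl <;> simp [hι _]
    | trans a b c _ _ ih ih' =>
      rcases ih with rfl | rfl <;> rcases ih' with rfl | rfl <;> simp [hι _]
  · rintro (rfl | rfl)
    · rfl
    · exact Quot.sound rfl

open Classical in
theorem mapDomain_apply_eq_sum {α β A : Type*} [Fintype α] [AddCommGroup A] (f : α → β)
    (z : α →₀ A) (b : β) : Finsupp.mapDomain f z b = ∑ x with f x = b, z x := by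
  induction z using Finsupp.induction_linear with
  | zero => simp
  | add z w hz hw => simp [Finsupp.mapDomain_add, hz, hw, Finset.sum_add_distrib]
  | single x a =>
    rw [Finsupp.mapDomain_single, Finset.sum_filter]
    simp only [Finsupp.single_apply]
    rw [Finset.sum_eq_single x]
    · simp
    · intro y _ hy; simp [hy.symm]
    · simp

/-- A finitely supported function whose sums over the fibres of `q` vanish is a combination of
differences of elements with the same image. -/
theorem mem_of_mapDomain_eq_zero {α β A : Type*} [AddCommGroup A] (q : α → β)
    (S : Submodule ℤ (α →₀ A))
    (hS : ∀ x y a, q x = q y → Finsupp.single x a - Finsupp.single y a ∈ S)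
    (z : α →₀ A) (hz : Finsupp.mapDomain q z = 0) : z ∈ S := by
  classical
  cases isEmpty_or_nonempty α
  · rw [Subsingleton.elim z 0]; exact S.zero_mem
  -- Pushing w along `Function.invFun q ∘ q` moves every point to a chosen representative of its
  -- fibre; for z the result is zero.
  have key : ∀ w : α →₀ A, w - Finsupp.mapDomain (Function.invFun q ∘ q) w ∈ S := by
    intro w
    induction w using Finsupp.induction_linear with
    | zero => simp
    | add w w' hw hw' =>
      rw [Finsupp.mapDomain_add, add_sub_add_comm]
      exact S.add_mem hw hw'
    | single x a =>
      rw [Finsupp.mapDomain_single]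
      exact hS _ _ _ (Function.invFun_eq ⟨x, rfl⟩).symm
  simpa [Finsupp.mapDomain_comp, hz] using key z

/-! ### Coefficients of the cellular boundary maps -/

namespace CellComplex

variable (D : CellComplex) {A : Type} [AddCommGroup A]

theorem d₁_single (e : D.Edge) (a : A) :
    D.d₁ A (Finsupp.single e a) = Finsupp.single (D.tgt e) a - Finsupp.single (D.src e) a := by
  simp [d₁]

theorem d₁_apply_eq (z : D.Edge →₀ A) :
    D.d₁ A z = Finsupp.mapDomain D.tgt z - Finsupp.mapDomain D.src z := rfl

theorem d₂_single_apply (f : D.Face) (a : A) (e : D.Edge) :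
    D.d₂ A (Finsupp.single f a) e = D.bdry f e • a := by
  classical
  rw [d₂, Finsupp.lsum_single, Finsupp.sum, LinearMap.sum_apply, Finsupp.finsetSum_apply]
  simp only [LinearMap.smul_apply, Finsupp.lsingle_apply, Finsupp.smul_apply]
  rw [Finset.sum_eq_single e]
  · simp
  · intro b _ hb; simp [hb]
  · intro h; simp [Finsupp.notMem_support_iff.1 h]

end CellComplex

/-! ### Corners -/

namespace EvenOrd

variable (σ : EvenOrd)

@[simp] theorem rev_rev : σ.rev.rev = σ := by
  simp only [rev, mul_assoc]; exact mul_eq_left.2 (by decide)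

@[simp] theorem fwd_bwd : σ.bwd.fwd = σ := by
  simp only [fwd, bwd, mul_assoc]; exact mul_eq_left.2 (by decide)

@[simp] theorem bwd_fwd : σ.fwd.bwd = σ := by
  simp only [fwd, bwd, mul_assoc]; exact mul_eq_left.2 (by decide)

@[simp] theorem fwd_fwd : σ.fwd.fwd = σ.bwd := by
  simp only [fwd, bwd, mul_assoc]; congr 1; decide

@[simp] theorem bwd_bwd : σ.bwd.bwd = σ.fwd := by
  simp only [fwd, bwd, mul_assoc]; congr 1; decide

-- This is the relation `(rev fwd)³ = 1` of the alternating group; it gives the normal forms used to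
-- compare corners of different links.
@[simp] theorem rev_fwd_rev : σ.rev.fwd.rev = σ.bwd.rev.bwd := by
  simp only [fwd, bwd, rev, mul_assoc]; congr 1; decide

@[simp] theorem rev_bwd_rev : σ.rev.bwd.rev = σ.fwd.rev.fwd := by
  simp only [fwd, bwd, rev, mul_assoc]; congr 1; decide

@[simp] theorem rev_zero : σ.rev.1 0 = σ.1 1 := rfl
@[simp] theorem fwd_one : σ.fwd.1 1 = σ.1 2 := rfl
@[simp] theorem bwd_zero : σ.bwd.1 0 = σ.1 0 := rfl
@[simp] theorem bwd_three : σ.bwd.1 3 = σ.1 2 := rfl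

theorem eq_or_of_apply_zero_eq {σ τ : EvenOrd} (h : σ.1 0 = τ.1 0) :
    σ = τ ∨ σ = τ.fwd ∨ σ = τ.bwd := by
  have key : ∀ π : Perm (Fin 4), Perm.sign π = 1 → π 0 = 0 →
    π = 1 ∨ π = swap 1 2 * swap 2 3 ∨ π = swap 2 3 * swap 1 2 := by decide
  have := key (τ⁻¹ * σ : EvenOrd).1 (Perm.mem_alternatingGroup.1 (τ⁻¹ * σ).2) (by
    change τ.1⁻¹ (σ.1 0) = 0
    rw [h]; exact τ.1.symm_apply_apply 0)
  simpa only [Subtype.ext_iff, fwd, bwd, Subgroup.coe_mul, Subgroup.coe_inv, inv_mul_eq_iff_eq_mul,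
    mul_one] using this

theorem eq_or_of_apply_three_eq {σ τ : EvenOrd} (h : σ.1 3 = τ.1 3) :
    σ = τ ∨ σ = τ.rev.bwd ∨ σ = τ.fwd.rev := by
  have key : ∀ π : Perm (Fin 4), Perm.sign π = 1 → π 3 = 3 →
    π = 1 ∨ π = swap 0 1 * swap 2 3 * (swap 2 3 * swap 1 2) ∨
      π = swap 1 2 * swap 2 3 * (swap 0 1 * swap 2 3) := by decide
  have := key (τ⁻¹ * σ : EvenOrd).1 (Perm.mem_alternatingGroup.1 (τ⁻¹ * σ).2) (by
    change τ.1⁻¹ (σ.1 3) = 3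
    rw [h]; exact τ.1.symm_apply_apply 3)
  simpa only [Subtype.ext_iff, rev, fwd, bwd, Subgroup.coe_mul, Subgroup.coe_inv,
    inv_mul_eq_iff_eq_mul, mul_one, mul_assoc] using this

end EvenOrd

namespace Corner

variable {N : ℕ} (x : Corner N)

/-- The corner at `ik` of the same triangle, where `(i, j, k, l)` is even. -/
def fwd (x : Corner N) : Corner N := (x.1, x.2.fwd)

@[simp] theorem rev_rev : x.rev.rev = x := by simp [rev]
@[simp] theorem fwd_bwd : x.bwd.fwd = x := by simp [fwd, bwd]
@[simp] theorem bwd_fwd : x.fwd.bwd = x := by simp [fwd, bwd]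
@[simp] theorem fwd_fwd : x.fwd.fwd = x.bwd := by simp [fwd, bwd]
@[simp] theorem bwd_bwd : x.bwd.bwd = x.fwd := by simp [fwd, bwd]
@[simp] theorem rev_fwd_rev : x.rev.fwd.rev = x.bwd.rev.bwd := by simp [fwd, bwd, rev]
@[simp] theorem rev_bwd_rev : x.rev.bwd.rev = x.fwd.rev.fwd := by simp [fwd, bwd, rev]

@[simp] theorem tri_fwd : x.fwd.tri = x.tri := rfl
@[simp] theorem tri_bwd : x.bwd.tri = x.tri := rfl

/-- The face `ijk` of the tetrahedron, where `(i, j, k, l)` is even. -/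
def opp (x : Corner N) : Fin N × Fin 4 := (x.1, x.2.1 3)

@[simp] theorem opp_rev_bwd : x.rev.bwd.opp = x.opp := rfl
@[simp] theorem opp_fwd_rev : x.fwd.rev.opp = x.opp := rfl

theorem opp_surjective (a : Fin N × Fin 4) : ∃ x : Corner N, x.opp = a := by
  obtain ⟨t, f⟩ := a
  have key : ∀ f : Fin 4, ∃ π : Perm (Fin 4), Perm.sign π = 1 ∧ π 3 = f := by decide
  obtain ⟨π, h1, h2⟩ := key f
  exact ⟨(t, ⟨π, Perm.mem_alternatingGroup.2 h1⟩), by simp [opp, h2]⟩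

theorem tri_eq_tri_iff {x y : Corner N} : x.tri = y.tri ↔ x = y ∨ x = y.fwd ∨ x = y.bwd := by
  constructor
  · obtain ⟨t, σ⟩ := x
    obtain ⟨s, τ⟩ := y
    intro h
    obtain ⟨h1, h2⟩ := Prod.ext_iff.1 h
    obtain rfl : t = s := h1
    rcases EvenOrd.eq_or_of_apply_zero_eq (σ := σ) (τ := τ) h2 with rfl | rfl | rfl <;> simp [fwd, bwd]
  · rintro (rfl | rfl | rfl) <;> simp

/-- With l fixed, `rev.bwd` and `fwd.rev` rotate the face ijk to jki and to kij. -/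
theorem opp_eq_opp_iff {x y : Corner N} :
    x.opp = y.opp ↔ x = y ∨ x = y.rev.bwd ∨ x = y.fwd.rev := by
  constructor
  · obtain ⟨t, σ⟩ := x
    obtain ⟨s, τ⟩ := y
    intro h
    obtain ⟨h1, h2⟩ := Prod.ext_iff.1 h
    obtain rfl : t = s := h1
    rcases EvenOrd.eq_or_of_apply_three_eq (σ := σ) (τ := τ) h2 with rfl | rfl | rfl <;> simp [fwd, bwd, rev]
  · rintro (rfl | rfl | rfl) <;> simp

theorem ne_of_apply_ne {x y : Corner N} (i : Fin 4) (h : x.2.1 i ≠ y.2.1 i) : x ≠ y := by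
  rintro rfl; exact h rfl

theorem sum_opp_eq {A : Type*} [AddCommMonoid A] (y : Corner N) (f : Corner N → A) :
    ∑ x : Corner N with x.opp = y.opp, f x = f y + f y.rev.bwd + f y.fwd.rev := by
  classical
  have : (Finset.univ.filter fun x : Corner N => x.opp = y.opp) = {y, y.rev.bwd, y.fwd.rev} := by
    ext x; simp [opp_eq_opp_iff]
  have h1 : y ≠ y.rev.bwd := ne_of_apply_ne 0 (by simp [rev, bwd])
  have h2 : y ≠ y.fwd.rev := ne_of_apply_ne 0 (by simp [rev, fwd])
  have h3 : y.rev.bwd ≠ y.fwd.rev := ne_of_apply_ne 0 (by simp [rev, bwd, fwd])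
  rw [this, Finset.sum_insert (by simp [h1, h2]), Finset.sum_insert (by simp [h3]),
    Finset.sum_singleton, add_assoc]

end Corner

namespace Corner

theorem apply_eq_of_tri_eq {N : ℕ} {A : Type*} {q : Corner N → A} (hq : ∀ x, q x.fwd = q x) {x y : Corner N}
    (h : x.tri = y.tri) : q x = q y := by
  rcases tri_eq_tri_iff.1 h with rfl | rfl | rfl
  · rfl
  · exact hq y
  · rw [← hq y.bwd, fwd_bwd]

end Corner

namespace Complex

variable {N : ℕ} (K : Complex N)

/-! ### The gluing maps -/

/-- The other copy, in the tetrahedra, of a face of `K`. -/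
def other (a : Fin N × Fin 4) : Fin N × Fin 4 := (K.nbr a.1 a.2, K.glue a.1 a.2 a.2)

theorem other_other (a : Fin N × Fin 4) : K.other (K.other a) = a := by
  simp [other, K.nbr_nbr, K.glue_glue]

theorem other_ne (a : Fin N × Fin 4) : K.other a ≠ a := K.not_self a.1 a.2

theorem face_eq_face_iff (a b : Fin N × Fin 4) : K.face a = K.face b ↔ b = a ∨ b = K.other a :=
  quot_mk_eq_iff_of_involutive K.other_other a b

theorem opp_flip (x : Corner N) : (K.flip x).opp = K.other x.opp := by
  simp [flip, Corner.opp, other, swap_apply_of_ne_of_ne]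

@[simp] theorem flip_flip (x : Corner N) : K.flip (K.flip x) = x := by
  have h3 : (K.flip x).2.1 3 = K.glue x.1 (x.2.1 3) (x.2.1 3) := by
    simp [flip, swap_apply_of_ne_of_ne]
  have h1 : (K.flip x).1 = K.nbr x.1 (x.2.1 3) := rfl
  have h2 : (K.flip x).2.1 = K.glue x.1 (x.2.1 3) * x.2.1 * swap 1 2 := rfl
  refine Prod.ext ?_ (Subtype.ext ?_)
  · change K.nbr (K.flip x).1 ((K.flip x).2.1 3) = x.1
    rw [h3, h1, K.nbr_nbr]
  · change K.glue (K.flip x).1 ((K.flip x).2.1 3) * (K.flip x).2.1 * swap 1 2 = x.2.1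
    rw [h3, h1, K.glue_glue, h2]
    simp [mul_assoc]

theorem flip_ne (x : Corner N) : K.flip x ≠ x := fun h =>
  K.other_ne x.opp (by rw [← opp_flip, h])

theorem next_eq (x : Corner N) : K.next x = K.flip x.bwd := by
  refine Prod.ext rfl (Subtype.ext ?_)
  change _ = K.glue x.1 (x.2.1 2) * (x.2.1 * (swap 2 3 * swap 1 2)) * swap 1 2
  simp [next, mul_assoc]

-- Gluing reverses orientation, so a rotation of one copy of the face becomes the opposite rotation
-- of the other copy.
@[simp] theorem flip_rev_bwd (x : Corner N) : K.flip x.rev.bwd = (K.flip x).fwd.rev := by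
  refine Prod.ext rfl (Subtype.ext ?_)
  change K.glue x.1 (x.2.1 3) * (x.2.1 * (swap 0 1 * swap 2 3) * (swap 2 3 * swap 1 2)) * swap 1 2 =
    K.glue x.1 (x.2.1 3) * x.2.1 * swap 1 2 * (swap 1 2 * swap 2 3) * (swap 0 1 * swap 2 3)
  simp only [mul_assoc]
  congr 2
  decide

@[simp] theorem flip_fwd_rev (x : Corner N) : K.flip x.fwd.rev = (K.flip x).rev.bwd := by
  have := K.flip_rev_bwd (K.flip x)
  rw [flip_flip] at this
  rw [← this, flip_flip]

/-- Turning around an edge becomes turning the opposite way when seen from its other end; this makes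
`revEdge` well defined. -/
theorem rev_next_rev_next (x : Corner N) : K.next (K.next x).rev = x.rev := by
  have : (K.flip x.bwd).rev.bwd = K.flip x.bwd.fwd.rev := (K.flip_fwd_rev _).symm
  rw [next_eq, next_eq, this, flip_flip, Corner.fwd_bwd]

/-- The permutation `next` of the corners. -/
def nextEquiv : Corner N ≃ Corner N where
  toFun := K.next
  invFun x := (K.flip x).fwd
  left_inv x := by simp [next_eq]
  right_inv x := by simp [next_eq]

/-- The corner before `x` around the same oriented edge of `K`. -/
def prev (x : Corner N) : Corner N := (K.flip x).fwd

@[simp] theorem next_prev (x : Corner N) : K.next (K.prev x) = x := K.nextEquiv.right_inv x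
@[simp] theorem prev_next (x : Corner N) : K.prev (K.next x) = x := K.nextEquiv.left_inv x

theorem next_eq_iff (x y : Corner N) : K.next x = y ↔ x = K.prev y :=
  (Equiv.eq_symm_apply K.nextEquiv).symm

theorem orEdge_next (x : Corner N) : K.orEdge (K.next x) = K.orEdge x :=
  (Quot.sound (r := fun x y : Corner N => y = K.next x) rfl).symm

theorem orEdge_prev (x : Corner N) : K.orEdge (K.prev x) = K.orEdge x := by
  rw [← orEdge_next, next_prev]

theorem side_eq_side_iff (x y : Corner N) : K.side x = K.side y ↔ y = x ∨ y = K.flip x :=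
  quot_mk_eq_iff_of_involutive K.flip_flip x y

@[simp] theorem side_flip (x : Corner N) : K.side (K.flip x) = K.side x :=
  (Quot.sound (r := fun x y : Corner N => y = K.flip x) rfl).symm

/-- Reversal of the oriented edges of `K`. -/
def revEdge : K.OrEdge → K.OrEdge :=
  Quot.lift (fun x => K.orEdge x.rev) fun x y h => by
    rw [h, ← K.rev_next_rev_next x, orEdge_next]

@[simp] theorem revEdge_orEdge (x : Corner N) : K.revEdge (K.orEdge x) = K.orEdge x.rev := rfl

theorem revEdge_revEdge (v : K.OrEdge) : K.revEdge (K.revEdge v) = v := by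
  induction v using Quot.ind with
  | mk x => exact congrArg K.orEdge x.rev_rev

theorem orEdge_rev_eq_iff (x : Corner N) (v : K.OrEdge) :
    K.orEdge x.rev = v ↔ K.orEdge x = K.revEdge v := by
  rw [← revEdge_orEdge, (Function.Involutive.eq_iff K.revEdge_revEdge)]

instance : Finite K.OrEdge := Quot.finite _
instance : Finite K.Side := Quot.finite _

theorem side_surjective (s : K.Side) : ∃ x, K.side x = s := Quot.exists_rep s

/-! ### Sums over the corners around an edge -/

open Classical in
theorem sum_orEdge_next {A : Type*} [AddCommMonoid A] (v : K.OrEdge) (f : Corner N → A) :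
    ∑ x with K.orEdge x = v, f (K.next x) = ∑ x with K.orEdge x = v, f x := by
  refine Finset.sum_equiv K.nextEquiv (fun x => ?_) fun x _ => rfl
  simp only [Finset.mem_filter_univ]
  rw [show K.nextEquiv x = K.next x from rfl, orEdge_next]

open Classical in
theorem sum_orEdge_rev {A : Type*} [AddCommMonoid A] (v : K.OrEdge) (f : Corner N → A) :
    ∑ x with K.orEdge x = v, f x.rev = ∑ x with K.orEdge x = K.revEdge v, f x := by
  refine Finset.sum_nbij' (fun x => x.rev) (fun x => x.rev) ?_ ?_ ?_ ?_ ?_ <;>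
    simp +contextual [orEdge_rev_eq_iff, revEdge_revEdge]

open Classical in
theorem sum_face_eq {A : Type*} [AddCommMonoid A] (a : Fin N × Fin 4) (f : Fin N × Fin 4 → A) :
    ∑ b with K.face b = K.face a, f b = f a + f (K.other a) := by
  have : (Finset.univ.filter fun b => K.face b = K.face a) = {a, K.other a} := by
    ext b
    rw [Finset.mem_filter_univ, eq_comm, face_eq_face_iff]; simp
  rw [this, Finset.sum_pair (K.other_ne a).symm]

open Classical in
theorem sum_side_eq {A : Type*} [AddCommMonoid A] (y : Corner N) (f : Corner N → A) :
    ∑ x with K.side x = K.side y, f x = f y + f (K.flip y) := by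
  have : (Finset.univ.filter fun x => K.side x = K.side y) = {y, K.flip y} := by
    ext x
    rw [Finset.mem_filter_univ, eq_comm, side_eq_side_iff]; simp
  rw [this, Finset.sum_pair (K.flip_ne y).symm]

/-! ### Cycles and boundaries of the cell decompositions -/

section Chains

variable {A : Type} [AddCommGroup A]

open Classical in
theorem d₁_D_apply_side (z : Corner N →₀ A) (y : Corner N) :
    K.D.d₁ A z (K.side y) = z y.fwd - z y + (z (K.flip y).fwd - z (K.flip y)) := by
  rw [CellComplex.d₁_apply_eq, Finsupp.sub_apply, mapDomain_apply_eq_sum, mapDomain_apply_eq_sum]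
  have : ∑ x : Corner N with K.side x.bwd = K.side y, z x =
      ∑ x with K.side x = K.side y, z x.fwd :=
    Finset.sum_nbij' (fun x => x.bwd) (fun x => x.fwd) (by simp) (by simp) (by simp) (by simp)
      (by simp)
  change ∑ x : Corner N with K.side x.bwd = K.side y, z x - ∑ x with K.side x = K.side y, z x = _
  rw [this, sum_side_eq, sum_side_eq]
  abel

/-- A midpoint lies on two triangles; in each, one arc ends and one starts there, so the two jumps
of a cycle cancel. -/
theorem mem_Z₁_D {z : Corner N →₀ A} (hz : z ∈ K.D.Z₁ A) (y : Corner N) :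
    z (K.flip y).fwd - z (K.flip y) = -(z y.fwd - z y) := by
  have := K.d₁_D_apply_side z y
  rw [LinearMap.mem_ker.1 hz, Finsupp.zero_apply] at this
  exact eq_neg_of_add_eq_zero_right this.symm

theorem mem_Z₁_D_iff {z : Corner N →₀ A} : z ∈ K.D.Z₁ A ↔
    ∀ y, z (K.flip y).fwd - z (K.flip y) = -(z y.fwd - z y) := by
  refine ⟨K.mem_Z₁_D, fun h => LinearMap.mem_ker.2 (Finsupp.ext fun s => ?_)⟩
  obtain ⟨y, rfl⟩ := K.side_surjective s
  rw [d₁_D_apply_side, h y]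
  exact add_neg_cancel _

open Classical in
theorem d₁_D'_apply_vert (z : Corner N →₀ A) (v : K.OrEdge) :
    K.D'.d₁ A z (Sum.inl v) = -∑ x with K.orEdge x = v, z x := by
  rw [CellComplex.d₁_apply_eq, Finsupp.sub_apply, mapDomain_apply_eq_sum, mapDomain_apply_eq_sum]
  simp

theorem d₁_D'_apply_ctr (z : Corner N →₀ A) (a : Fin N × Fin 4) :
    K.D'.d₁ A z (Sum.inr a) = ∑ x : Corner N with x.tri = a, z x := by
  rw [CellComplex.d₁_apply_eq, Finsupp.sub_apply, mapDomain_apply_eq_sum, mapDomain_apply_eq_sum]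
  simp

open Classical in
theorem mem_Z₁_D'_iff {z : Corner N →₀ A} : z ∈ K.D'.Z₁ A ↔
    (∀ v, ∑ x with K.orEdge x = v, z x = 0) ∧ ∀ a, ∑ x : Corner N with x.tri = a, z x = 0 := by
  constructor
  · intro h
    refine ⟨fun v => ?_, fun a => ?_⟩
    · rw [← neg_eq_zero, ← d₁_D'_apply_vert, LinearMap.mem_ker.1 h]; rfl
    · rw [← K.d₁_D'_apply_ctr, LinearMap.mem_ker.1 h]; rfl
  · rintro ⟨h1, h2⟩
    refine LinearMap.mem_ker.2 (Finsupp.ext ?_)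
    rintro (v | a)
    · rw [d₁_D'_apply_vert, h1]; exact neg_zero
    · rw [d₁_D'_apply_ctr, h2]; rfl

theorem d₂_D_apply (u : (Fin N × Fin 4) ⊕ K.OrEdge →₀ A) (x : Corner N) :
    K.D.d₂ A u x = u (Sum.inl x.tri) + u (Sum.inr (K.orEdge x)) := by
  classical
  induction u using Finsupp.induction_linear with
  | zero => simp
  | add u w hu hw => rw [map_add, Finsupp.add_apply, hu, hw]; simp only [Finsupp.add_apply]; abel
  | single f a =>
    rw [CellComplex.d₂_single_apply]
    rcases f with f | f
    · simp [Finsupp.finsetSum_apply, Finsupp.single_apply, eq_comm]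
    · simp [Finsupp.finsetSum_apply, Finsupp.single_apply, eq_comm]

theorem d₂_D'_apply (u : K.Side →₀ A) (x : Corner N) :
    K.D'.d₂ A u x = u (K.side x.bwd) - u (K.side x) := by
  classical
  induction u using Finsupp.induction_linear with
  | zero => simp
  | add u w hu hw => rw [map_add, Finsupp.add_apply, hu, hw]; simp only [Finsupp.add_apply]; abel
  | single f a =>
    rw [CellComplex.d₂_single_apply]
    simp [Finsupp.single_apply, eq_comm, sub_smul]

theorem mem_B₁_D {z : Corner N →₀ A} (p : Fin N × Fin 4 → A) (q : K.OrEdge → A)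
    (h : ∀ x, z x = p x.tri + q (K.orEdge x)) : z ∈ K.D.B₁ A := by
  refine ⟨Finsupp.equivFunOnFinite.symm (Sum.elim p q), Finsupp.ext fun x => ?_⟩
  rw [d₂_D_apply, h]; rfl

/-- A chain of `𝒟'` is a boundary if it is the coboundary of a function of the sides. -/
theorem mem_B₁_D' {z : Corner N →₀ A} (S : Corner N → A) (hS : ∀ x, S (K.flip x) = S x)
    (h : ∀ x, z x = S x.bwd - S x) : z ∈ K.D'.B₁ A := by
  refine ⟨Finsupp.equivFunOnFinite.symm (Quot.lift S fun x y hxy => by rw [hxy, hS]),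
    Finsupp.ext fun x => ?_⟩
  rw [d₂_D'_apply, h]; rfl

/-! ### The common subdivision -/

section Overlay

variable (u : OverlayFace N →₀ A) (x : Corner N)

theorem d₂_overlay_first :
    K.overlay.d₂ A u (.first x) = u (.outer (K.prev x)) + u (.inner x.fwd) := by
  classical
  induction u using Finsupp.induction_linear with
  | zero => simp
  | add u w hu hw => rw [map_add, Finsupp.add_apply, hu, hw]; simp only [Finsupp.add_apply]; abel
  | single f a =>
    rw [CellComplex.d₂_single_apply]
    rcases f with y | y
    · simp [Finsupp.single_apply, next_eq_iff]
    · have : y.bwd = x ↔ y = x.fwd := ⟨by rintro rfl; simp, by rintro rfl; simp⟩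
      simp [Finsupp.single_apply, this]

theorem d₂_overlay_second :
    K.overlay.d₂ A u (.second x) = u (.outer x) + u (.inner x) := by
  classical
  induction u using Finsupp.induction_linear with
  | zero => simp
  | add u w hu hw => rw [map_add, Finsupp.add_apply, hu, hw]; simp only [Finsupp.add_apply]; abel
  | single f a =>
    rw [CellComplex.d₂_single_apply]
    rcases f with y | y <;> simp [Finsupp.single_apply]

theorem d₂_overlay_outer :
    K.overlay.d₂ A u (.outer x) = u (.outer x) - u (.outer (K.prev x)) := by
  classical
  induction u using Finsupp.induction_linear with
  | zero => simp
  | add u w hu hw => rw [map_add, Finsupp.add_apply, hu, hw]; simp only [Finsupp.add_apply]; abel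
  | single f a =>
    rw [CellComplex.d₂_single_apply]
    rcases f with y | y <;> simp [Finsupp.single_apply, next_eq_iff, sub_smul]

theorem d₂_overlay_inner :
    K.overlay.d₂ A u (.inner x) = u (.inner x.fwd) - u (.inner x) := by
  classical
  induction u using Finsupp.induction_linear with
  | zero => simp
  | add u w hu hw => rw [map_add, Finsupp.add_apply, hu, hw]; simp only [Finsupp.add_apply]; abel
  | single f a =>
    rw [CellComplex.d₂_single_apply]
    have (y : Corner N) : y.bwd = x ↔ y = x.fwd := ⟨by rintro rfl; simp, by rintro rfl; simp⟩
    rcases f with y | y <;> simp [Finsupp.single_apply, this, sub_smul]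

variable (z z' : Corner N →₀ A)

theorem sd_apply : K.sd A z (.first x) = z x ∧ K.sd A z (.second x) = z x ∧
    K.sd A z (.outer x) = 0 ∧ K.sd A z (.inner x) = 0 := by
  classical
  induction z using Finsupp.induction_linear with
  | zero => simp
  | add z w hz hw => simp [hz, hw]
  | single y a => simp [sd, Finsupp.single_apply]

theorem sd'_apply : K.sd' A z (.first x) = 0 ∧ K.sd' A z (.second x) = 0 ∧
    K.sd' A z (.outer x) = z x ∧ K.sd' A z (.inner x) = z x := by
  classical
  induction z using Finsupp.induction_linear with
  | zero => simp
  | add z w hz hw => simp [hz, hw]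
  | single y a => simp [sd', Finsupp.single_apply]

/-- The coefficients of a homology from a chain of `𝒟` to a chain of `𝒟'`. -/
theorem sd_sub_sd'_mem_B₁_iff : K.sd A z - K.sd' A z' ∈ K.overlay.B₁ A ↔
    ∃ p q : Corner N → A, ∀ x, z x = p (K.prev x) + q x.fwd ∧ z x = p x + q x ∧
      z' x = p (K.prev x) - p x ∧ z' x = q x - q x.fwd := by
  constructor
  · rintro ⟨u, hu⟩
    refine ⟨fun x => u (.outer x), fun x => u (.inner x), fun x => ?_⟩
    have h1 := K.d₂_overlay_first u x
    have h2 := K.d₂_overlay_second u x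
    have h3 := K.d₂_overlay_outer u x
    have h4 := K.d₂_overlay_inner u x
    obtain ⟨a1, a2, a3, a4⟩ := K.sd_apply x z
    obtain ⟨b1, b2, b3, b4⟩ := K.sd'_apply x z'
    rw [hu, Finsupp.sub_apply] at h1 h2 h3 h4
    rw [a1, b1, sub_zero] at h1
    rw [a2, b2, sub_zero] at h2
    rw [a3, b3, zero_sub, neg_eq_iff_eq_neg, neg_sub] at h3
    rw [a4, b4, zero_sub, neg_eq_iff_eq_neg, neg_sub] at h4
    exact ⟨h1, h2, h3, h4⟩
  · rintro ⟨p, q, h⟩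
    let u : OverlayFace N → A := fun
      | .outer x => p x
      | .inner x => q x
    have hfin : Finite (OverlayFace N) := Finite.of_surjective
      (fun y : Corner N ⊕ Corner N => Sum.elim OverlayFace.outer OverlayFace.inner y) (by
        rintro (x | x)
        exacts [⟨Sum.inl x, rfl⟩, ⟨Sum.inr x, rfl⟩])
    refine ⟨Finsupp.equivFunOnFinite.symm u, Finsupp.ext ?_⟩
    rintro (x | x | x | x) <;> obtain ⟨h1, h2, h3, h4⟩ := h x <;>
      obtain ⟨a1, a2, a3, a4⟩ := K.sd_apply x z <;> obtain ⟨b1, b2, b3, b4⟩ := K.sd'_apply x z' <;>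
      rw [Finsupp.sub_apply]
    · rw [a1, b1, sub_zero, h1]; exact d₂_overlay_first ..
    · rw [a2, b2, sub_zero, h2]; exact d₂_overlay_second ..
    · rw [a3, b3, zero_sub, h3, neg_sub]; exact d₂_overlay_outer ..
    · rw [a4, b4, zero_sub, h4, neg_sub]; exact d₂_overlay_inner ..

/-- For z' = 0 the equations say that q is constant on triangles and p is constant around vertices,
so z = p + q bounds in 𝒟. -/
theorem sd_mem_B₁_iff : K.sd A z ∈ K.overlay.B₁ A ↔ z ∈ K.D.B₁ A := by
  have key := K.sd_sub_sd'_mem_B₁_iff z 0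
  rw [map_zero, sub_zero] at key
  rw [key]
  constructor
  · rintro ⟨p, q, h⟩
    have hq : ∀ x, q x.fwd = q x := fun x => (sub_eq_zero.1 (h x).2.2.2.symm).symm
    have hp : ∀ x, p (K.next x) = p x := fun x => by
      have := (h (K.next x)).2.2.1
      rw [prev_next] at this
      exact (sub_eq_zero.1 this.symm).symm
    -- Every triangle has corners, so the default value `0` is never taken.
    refine K.mem_B₁_D (Function.extend Corner.tri q 0)
      (Quot.lift p fun x y hxy => by rw [hxy, hp]) fun x => ?_
    have : Function.extend Corner.tri q 0 x.tri = q x :=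
      Function.FactorsThrough.extend_apply (fun x y h => Corner.apply_eq_of_tri_eq hq h) _ _
    rw [this, (h x).2.1, add_comm]; rfl
  · rintro ⟨u, rfl⟩
    refine ⟨fun x => u (Sum.inr (K.orEdge x)), fun x => u (Sum.inl x.tri), fun x => ?_⟩
    have := K.d₂_D_apply u x
    simp [orEdge_prev, this.trans (add_comm _ _)]

/-- For z = 0 the equations give q = -p, and p takes the same value on the two outer quadrilaterals
at a side, so it descends to the sides. -/
theorem sd'_mem_B₁_iff : K.sd' A z ∈ K.overlay.B₁ A ↔ z ∈ K.D'.B₁ A := by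
  have key := K.sd_sub_sd'_mem_B₁_iff 0 z
  rw [map_zero, zero_sub, Submodule.neg_mem_iff] at key
  rw [key]
  constructor
  · rintro ⟨p, q, h⟩
    have hp : ∀ x, p (K.prev x) = p x.fwd := fun x => by
      have h1 := (h x).1
      have h2 := (h x.fwd).2.1
      rw [Finsupp.zero_apply] at h1 h2
      exact add_right_cancel (h1.symm.trans h2)
    refine K.mem_B₁_D' (fun x => - p x.fwd) (fun x => ?_) fun x => ?_
    · rw [← hp]; simp [prev]
    · rw [(h x).2.2.1, hp, Corner.fwd_bwd]; abel
  · rintro ⟨u, rfl⟩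
    refine ⟨fun x => - u (K.side x.bwd), fun x => u (K.side x.bwd), fun x => ?_⟩
    have := K.d₂_D'_apply u x
    simp [prev, this, ← sub_eq_neg_add]

theorem exists_sd_sub_sd'_mem_of_mem_Z₁_D {z : Corner N →₀ A} (hz : z ∈ K.D.Z₁ A) :
    ∃ z' ∈ K.D'.Z₁ A, K.sd A z - K.sd' A z' ∈ K.overlay.B₁ A := by
  classical
  -- The two jumps of z at a side are opposite. Putting the whole jump on one chosen copy of the
  -- side and 0 on the other writes it as a difference.
  let w : Corner N → A := fun x => if x = Quot.out (K.side x) then z x.fwd - z x else 0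
  have hw : ∀ x, w x - w (K.flip x) = z x.fwd - z x := fun x => by
    have h1 : K.side (Quot.out (K.side x)) = K.side x := Quot.out_eq _
    have hz' := K.mem_Z₁_D hz x
    simp only [w, side_flip]
    rw [side_eq_side_iff] at h1
    rcases h1 with h1 | h1
    · rw [← h1, if_pos rfl, if_neg (K.flip_ne x), sub_zero]
    · have h2 : Quot.out (K.side x) = K.flip x := by
        nth_rw 2 [h1]; rw [flip_flip]
      rw [h2, if_pos rfl, if_neg (K.flip_ne x).symm, zero_sub, hz', neg_neg]
  -- The outer quadrilateral of x lies at the side named by `x.bwd`.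
  let p : Corner N → A := fun x => w x.bwd
  let q : Corner N → A := fun x => z x - p x
  have hpq : ∀ x, z x = p (K.prev x) + q x.fwd := fun x => by
    have := hw x
    simp only [p, q, prev, Corner.bwd_fwd]
    rw [← sub_eq_zero, ← sub_eq_zero.2 this]
    abel
  let z' : Corner N →₀ A := Finsupp.equivFunOnFinite.symm fun x => p (K.prev x) - p x
  have hz' : ∀ x, z' x = p (K.prev x) - p x := fun x => rfl
  have hz'' : ∀ x, z' x = q x - q x.fwd := fun x => by
    have h1 := hpq x
    have h2 : z x = p x + q x := by simp [q]
    rw [hz', eq_sub_of_add_eq h1.symm, eq_sub_of_add_eq h2.symm]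
    abel
  refine ⟨z', K.mem_Z₁_D'_iff.2 ⟨fun v => ?_, fun a => ?_⟩, (K.sd_sub_sd'_mem_B₁_iff _ _).2
    ⟨p, q, fun x => ⟨hpq x, by simp [q], hz' x, hz'' x⟩⟩⟩
  · simp only [hz']
    rw [Finset.sum_sub_distrib, ← K.sum_orEdge_next]
    simp
  · simp only [hz'']
    rw [Finset.sum_sub_distrib, sub_eq_zero]
    exact Finset.sum_nbij' (fun x => x.bwd) (fun x => x.fwd) (by simp) (by simp) (by simp) (by simp)
      (by simp)

/-- A cycle of 𝒟' has zero sum around each vertex and over each triangle. It therefore has a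
primitive p along `next` and a primitive q along `fwd`, and p + q is the required cycle. -/
theorem exists_sd_sub_sd'_mem_of_mem_Z₁_D' {z' : Corner N →₀ A} (hz' : z' ∈ K.D'.Z₁ A) :
    ∃ z ∈ K.D.Z₁ A, K.sd A z - K.sd' A z' ∈ K.overlay.B₁ A := by
  classical
  obtain ⟨h1, h2⟩ := K.mem_Z₁_D'_iff.1 hz'
  have hp : ∃ p : Corner N → A, ∀ x, z' x = p (K.prev x) - p x := by
    let S : Submodule ℤ (Corner N →₀ A) := LinearMap.range
      (Finsupp.lmapDomain A ℤ K.next - LinearMap.id)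
    have hS : z' ∈ S := by
      refine mem_of_mapDomain_eq_zero K.orEdge S (fun x y a hxy => ?_) z' (Finsupp.ext fun v => ?_)
      · replace hxy := Quot.eq.1 hxy
        induction hxy with
        | rel x y h =>
          subst h
          rw [← Submodule.neg_mem_iff]
          exact ⟨Finsupp.single x a, by simp⟩
        | refl x => simp
        | symm x y _ ih => rw [← Submodule.neg_mem_iff, neg_sub]; exact ih
        | trans x y w _ _ ih ih' => rw [← sub_add_sub_cancel]; exact S.add_mem ih ih'
      · rw [mapDomain_apply_eq_sum, h1]; rfl
    obtain ⟨w, rfl⟩ := hS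
    refine ⟨w, fun x => ?_⟩
    have : Finsupp.mapDomain K.next w x = w (K.prev x) := by
      conv_lhs => rw [← K.next_prev x]
      exact Finsupp.mapDomain_apply K.nextEquiv.injective _ _
    simp [this]
  have hq : ∃ q : Corner N → A, ∀ x, z' x = q x - q x.fwd := by
    let S : Submodule ℤ (Corner N →₀ A) := LinearMap.range
      (LinearMap.id - Finsupp.lmapDomain A ℤ Corner.bwd)
    have hstep : ∀ x a, Finsupp.single x a - Finsupp.single x.bwd a ∈ S := fun x a =>
      ⟨Finsupp.single x a, by simp⟩
    have hS : z' ∈ S := by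
      refine mem_of_mapDomain_eq_zero Corner.tri S (fun x y a hxy => ?_) z' (Finsupp.ext fun v => ?_)
      · rcases Corner.tri_eq_tri_iff.1 hxy with rfl | rfl | rfl
        · simp
        · simpa using hstep y.fwd a
        · rw [← Submodule.neg_mem_iff, neg_sub]; exact hstep y a
      · rw [mapDomain_apply_eq_sum, Finsupp.zero_apply, ← h2 v]; congr!
    obtain ⟨w, rfl⟩ := hS
    refine ⟨w, fun x => ?_⟩
    have : Finsupp.mapDomain Corner.bwd w x = w x.fwd := by
      conv_lhs => rw [← x.bwd_fwd]
      refine Finsupp.mapDomain_apply (Function.LeftInverse.injective (g := Corner.fwd) ?_) _ _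
      exact Corner.fwd_bwd
    simp [this]
  obtain ⟨p, hp⟩ := hp
  obtain ⟨q, hq⟩ := hq
  let z : Corner N →₀ A := Finsupp.equivFunOnFinite.symm fun x => p x + q x
  have hz : ∀ x, z x = p x + q x := fun x => rfl
  have hz2 : ∀ x, z x = p (K.prev x) + q x.fwd := fun x => by
    rw [hz, ← sub_eq_zero, ← sub_eq_zero.2 ((hq x).symm.trans (hp x))]; abel
  refine ⟨z, K.mem_Z₁_D_iff.2 fun y => ?_, (K.sd_sub_sd'_mem_B₁_iff _ _).2
    ⟨p, q, fun x => ⟨hz2 x, hz x, hp x, hq x⟩⟩⟩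
  rw [hz2 y, hz2 (K.flip y), hz, hz]
  simp only [prev, flip_flip]
  abel

theorem exists_isCanonical (A : Type) [AddCommGroup A] :
    ∃ κ : K.D.H₁ A ≃ₗ[ℤ] K.D'.H₁ A, K.IsCanonical κ :=
  exists_equiv_of_comparison (K.sd A) (K.sd' A) (fun z _ => K.sd_mem_B₁_iff z)
    (fun z _ => K.sd'_mem_B₁_iff z) (fun _ hz => K.exists_sd_sub_sd'_mem_of_mem_Z₁_D hz)
    fun _ hz => K.exists_sd_sub_sd'_mem_of_mem_Z₁_D' hz

end Overlay

end Chains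

end Complex

/-! ### The form on the coordinates -/

namespace Corner

variable {N : ℕ}

theorem rev_eq_iff {x y : Corner N} : x.rev = y ↔ x = y.rev :=
  ⟨by rintro rfl; simp, by rintro rfl; simp⟩

theorem fwd_eq_iff {x y : Corner N} : x.fwd = y ↔ x = y.bwd :=
  ⟨by rintro rfl; simp, by rintro rfl; simp⟩

theorem bwd_eq_iff {x y : Corner N} : x.bwd = y ↔ x = y.fwd :=
  ⟨by rintro rfl; simp, by rintro rfl; simp⟩

end Corner

open Corner

section Form

variable {N : ℕ}

/-- The coefficient of `e_ij` in an element of `J²`. -/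
def coordEdge (v : J2 N) (x : Corner N) : ℤ := v (x.1, .edge x.2)

/-- The coefficient of a face of a tetrahedron in an element of `J²`. -/
def coordFace (v : J2 N) (a : Fin N × Fin 4) : ℤ := v (a.1, .face a.2)

theorem coordEdge_add (v w : J2 N) (x : Corner N) :
    coordEdge (v + w) x = coordEdge v x + coordEdge w x := rfl

theorem coordFace_add (v w : J2 N) (a : Fin N × Fin 4) :
    coordFace (v + w) a = coordFace v a + coordFace w a := rfl

theorem coordEdge_smul (c : ℤ) (v : J2 N) (x : Corner N) :
    coordEdge (c • v) x = c * coordEdge v x := rfl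

theorem coordFace_smul (c : ℤ) (v : J2 N) (a : Fin N × Fin 4) :
    coordFace (c • v) a = c * coordFace v a := rfl

theorem coordEdge_eEdge (x y : Corner N) : coordEdge (eEdge x) y = if x = y then 1 else 0 := by
  classical
  obtain ⟨t, σ⟩ := x
  obtain ⟨s, τ⟩ := y
  simp [coordEdge, eEdge, Finsupp.single_apply]

theorem coordEdge_eFace (a : Fin N × Fin 4) (y : Corner N) : coordEdge (eFace a) y = 0 := by
  simp [coordEdge, eFace]

theorem coordFace_eEdge (x : Corner N) (a : Fin N × Fin 4) : coordFace (eEdge x) a = 0 := by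
  simp [coordFace, eEdge]

theorem coordFace_eFace (a b : Fin N × Fin 4) :
    coordFace (eFace a) b = if a = b then 1 else 0 := by
  classical
  obtain ⟨t, σ⟩ := a
  obtain ⟨s, τ⟩ := b
  simp [coordFace, eFace, Finsupp.single_apply]

theorem J2_induction {p : J2 N → Prop} (h0 : p 0) (hadd : ∀ v w, p v → p w → p (v + w))
    (hsmul : ∀ (c : ℤ) v, p v → p (c • v)) (hedge : ∀ x, p (eEdge x)) (hface : ∀ a, p (eFace a))
    (v : J2 N) : p v := by
  induction v using Finsupp.induction_linear with
  | zero => exact h0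
  | add v w hv hw => exact hadd v w hv hw
  | single a c =>
    rw [← mul_one c, ← smul_eq_mul, ← Finsupp.smul_single]
    obtain ⟨t, σ | f⟩ := a
    · exact hsmul c _ (hedge (t, σ))
    · exact hsmul c _ (hface (t, f))

theorem Ω2_single (a b : Fin N × Coord) : Ω2 N (Finsupp.single a 1) (Finsupp.single b 1) =
    if a.1 = b.1 then ε a.2 b.2 else 0 := by
  simp [Ω2]

theorem Ω2_skew (v w : J2 N) : Ω2 N v w = - Ω2 N w v := by
  induction v using Finsupp.induction_linear with
  | zero => simp
  | add v v' hv hv' => simp only [map_add, LinearMap.add_apply, hv, hv', neg_add]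
  | single a c =>
    induction w using Finsupp.induction_linear with
    | zero => simp
    | add w w' hw hw' => simp only [map_add, LinearMap.add_apply, hw, hw', neg_add]
    | single b d =>
      rw [← mul_one c, ← mul_one d, ← smul_eq_mul, ← smul_eq_mul, ← Finsupp.smul_single,
        ← Finsupp.smul_single]
      simp only [map_smul, LinearMap.smul_apply, Ω2_single, ε, smul_eq_mul]
      rcases eq_or_ne a.1 b.1 with h | h
      · rw [if_pos h, if_pos h.symm]; ring
      · rw [if_neg h, if_neg h.symm]; ring

theorem Ω2_eEdge (v : J2 N) (y : Corner N) : Ω2 N v (eEdge y) =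
    coordEdge v y.bwd - coordEdge v y.fwd + coordFace v y.opp - coordFace v y.bwd.opp := by
  induction v using J2_induction with
  | h0 => simp [coordEdge, coordFace]
  | hadd v w hv hw =>
    rw [map_add, LinearMap.add_apply, hv, hw]
    simp only [coordEdge_add, coordFace_add]; ring
  | hsmul c v hv =>
    rw [map_smul, LinearMap.smul_apply, hv]
    simp only [coordEdge_smul, coordFace_smul, smul_eq_mul]; ring
  | hedge x =>
    rw [coordEdge_eEdge, coordEdge_eEdge, coordFace_eEdge, coordFace_eEdge, eEdge, eEdge, Ω2_single]
    simp only [← fwd_eq_iff, ← bwd_eq_iff, ε, arrows]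
    obtain ⟨t, σ⟩ := x
    obtain ⟨s, τ⟩ := y
    have hσ : σ = τ.fwd ↔ σ.bwd = τ := ⟨by rintro rfl; simp, by rintro rfl; simp⟩
    by_cases h : t = s
    · simp [h, fwd, bwd, hσ, eq_comm]
    · simp [h, fwd, bwd]
  | hface a =>
    rw [coordEdge_eFace, coordEdge_eFace, coordFace_eFace, coordFace_eFace, eEdge, eFace, Ω2_single]
    obtain ⟨t, f⟩ := a
    obtain ⟨s, τ⟩ := y
    by_cases h : t = s
    · simp [h, opp, bwd, ε, arrows]
    · simp [h, opp, bwd]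

/-- Expanding the indicator of a face over its three rotations turns the face formulas below into
ring identities between indicators of corners. -/
theorem ite_opp_eq (x y : Corner N) : (if x.opp = y.opp then (1 : ℤ) else 0) =
    (if x = y then 1 else 0) + (if x = y.rev.bwd then 1 else 0) +
      (if x = y.fwd.rev then 1 else 0) := by
  have := sum_opp_eq y (fun w => if x = w then (1 : ℤ) else 0)
  rw [← this, Finset.sum_filter]
  simp only [← ite_and]
  rw [Finset.sum_eq_single x]
  · simp
  · intro w _ hw; simp [hw.symm]
  · simp

theorem Ω2_eFace (v : J2 N) (y : Corner N) : Ω2 N v (eFace y.opp) =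
    coordEdge v y.fwd + coordEdge v y.rev + coordEdge v y.fwd.rev.fwd
      - coordEdge v y - coordEdge v y.rev.bwd - coordEdge v y.fwd.rev := by
  induction v using J2_induction with
  | h0 => simp [coordEdge]
  | hadd v w hv hw =>
    rw [map_add, LinearMap.add_apply, hv, hw]
    simp only [coordEdge_add]; ring
  | hsmul c v hv =>
    rw [map_smul, LinearMap.smul_apply, hv]
    simp only [coordEdge_smul, smul_eq_mul]; ring
  | hedge x =>
    have h1 := ite_opp_eq x y
    have h2 := ite_opp_eq x.bwd y
    simp only [bwd_eq_iff, fwd_bwd] at h2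
    simp only [coordEdge_eEdge]
    have : Ω2 N (eEdge x) (eFace y.opp) = (if x.bwd.opp = y.opp then 1 else 0)
        - (if x.opp = y.opp then 1 else 0) := by
      rw [eEdge, eFace, Ω2_single]
      obtain ⟨t, σ⟩ := x
      obtain ⟨s, τ⟩ := y
      by_cases h : t = s
      · simp [h, opp, bwd, ε, arrows, eq_comm]
      · simp [h, opp, bwd]
    rw [this, h1, h2]
    ring
  | hface a =>
    simp only [coordEdge_eFace]
    rw [eFace, eFace, Ω2_single]
    simp [ε, arrows]

theorem Ω2_eq_zero {v : J2 N} (he : ∀ x, Ω2 N v (eEdge x) = 0) (hf : ∀ a, Ω2 N v (eFace a) = 0) :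
    Ω2 N v = 0 := by
  refine LinearMap.ext fun w => ?_
  induction w using J2_induction with
  | h0 => simp
  | hadd w w' h h' => rw [map_add, h, h']; simp
  | hsmul c w h => rw [map_smul, h]; simp
  | hedge x => exact he x
  | hface a => exact hf a

end Form

namespace Complex

variable {N : ℕ} (K : Complex N)

/-! ### The linearized holonomy -/

theorem h_single (x : Corner N) (l : L) : K.h (Finsupp.single x l) =
    l.2 • (2 : ℤ) • eEdge x + l.1 • ((2 : ℤ) • eEdge x.rev + eFace x.opp + eFace x.bwd.opp) := by
  rw [h, Finsupp.lsum_single]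
  simp only [LinearMap.add_apply, LinearMap.smulRight_apply, LinearMap.fst_apply,
    LinearMap.snd_apply, ofNat_smul_eq_nsmul, opp, bwd, EvenOrd.bwd_three]

theorem coordEdge_h (z : Corner N →₀ L) (y : Corner N) :
    coordEdge (K.h z) y = 2 * (z y).2 + 2 * (z y.rev).1 := by
  induction z using Finsupp.induction_linear with
  | zero => simp [coordEdge]
  | add z w hz hw =>
    rw [map_add, coordEdge_add, hz, hw]
    simp only [Finsupp.add_apply, Prod.fst_add, Prod.snd_add]; ring
  | single x l =>
    rw [h_single]
    simp only [coordEdge_add, coordEdge_smul, coordEdge_eEdge, coordEdge_eFace, rev_eq_iff,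
      Finsupp.single_apply]
    split_ifs <;> simp <;> ring

theorem coordFace_h (z : Corner N →₀ L) (y : Corner N) :
    coordFace (K.h z) y.opp = (z y).1 + (z y.rev.bwd).1 + (z y.fwd.rev).1
      + (z y.fwd).1 + (z y.rev).1 + (z y.fwd.rev.fwd).1 := by
  induction z using Finsupp.induction_linear with
  | zero => simp [coordFace]
  | add z w hz hw =>
    rw [map_add, coordFace_add, hz, hw]
    simp only [Finsupp.add_apply, Prod.fst_add]; ring
  | single x l =>
    have h1 := ite_opp_eq x y
    have h2 := ite_opp_eq x.bwd y
    simp only [bwd_eq_iff, fwd_bwd] at h2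
    have h3 (w : Corner N) : (Finsupp.single x l w).1 = l.1 * if x = w then 1 else 0 := by
      rw [Finsupp.single_apply]; split_ifs <;> simp
    rw [h_single]
    simp only [coordFace_add, coordFace_smul, coordFace_eEdge, coordFace_eFace, h1, h2, h3]
    ring

/-- `Ω² (h z) e_ij`, in terms of the differences of the coefficients of `z` on each side. -/
theorem Ω2_h_eEdge (z : Corner N →₀ L) (y : Corner N) : Ω2 N (K.h z) (eEdge y) =
    2 * ((z y.bwd).2 - (z y.fwd).2) - ((z y.bwd).1 - (z y.fwd).1)
      - ((z y.rev.fwd).1 - (z y.rev).1) - ((z y.rev).1 - (z y.rev.bwd).1)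
      + ((z y.bwd.rev).1 - (z y.bwd.rev.bwd).1) + ((z y.fwd.rev.fwd).1 - (z y.fwd.rev).1) := by
  rw [Ω2_eEdge, coordFace_h, coordFace_h, coordEdge_h, coordEdge_h, fwd_bwd]
  ring

theorem Ω2_h_eFace (z : Corner N →₀ L) (y : Corner N) : Ω2 N (K.h z) (eFace y.opp) =
    2 * (((z y.fwd).2 - (z y.fwd).1) - ((z y).2 - (z y).1)
      + (((z y.rev).2 - (z y.rev).1) - ((z y.rev.bwd).2 - (z y.rev.bwd).1))
      + (((z y.fwd.rev.fwd).2 - (z y.fwd.rev.fwd).1) - ((z y.fwd.rev).2 - (z y.fwd.rev).1))) := by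
  rw [Ω2_eFace]
  simp only [coordEdge_h, rev_rev, bwd_fwd, rev_fwd_rev, rev_bwd_rev]
  ring

/-- Only differences within one triangle occur. This puts the images of the inner triangles in Ker
p. -/
theorem Ω2_h_eq_zero_of_fwd {z : Corner N →₀ L} (hz : ∀ x, z x.fwd = z x) :
    Ω2 N (K.h z) = 0 := by
  have hz' : ∀ x, z x.bwd = z x := fun x => by rw [← hz x.bwd, fwd_bwd]
  refine Ω2_eq_zero (fun x => ?_) fun a => ?_
  · rw [Ω2_h_eEdge]; simp only [hz, hz']; ring
  · obtain ⟨y, rfl⟩ := opp_surjective a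
    rw [Ω2_h_eFace]; simp only [hz, hz']; ring

open Classical in
theorem F_single_edge (v : K.OrEdge) :
    K.F (Finsupp.single (Sum.inl v) 1) = ∑ x : Corner N with K.orEdge x = v, eEdge x := by
  simp [F]

theorem F_single_face (a : Fin N × Fin 4) :
    K.F (Finsupp.single (Sum.inr (K.face a)) 1) = eFace a + eFace (K.other a) := by
  classical
  rw [← K.sum_face_eq a (fun b => (eFace b : J2 N))]
  simp [F]

open Classical in
theorem h_polygon_mem (v : K.OrEdge) (l : L) :
    K.h (∑ x with K.orEdge x = v, Finsupp.single x l) ∈ LinearMap.range K.F := by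
  have h1 : ∑ x with K.orEdge x = v, (eEdge x.rev : J2 N) =
      K.F (Finsupp.single (Sum.inl (K.revEdge v)) 1) := by
    rw [F_single_edge, sum_orEdge_rev]
  -- Consecutive corners around v share a face: `x.bwd.opp` and `(K.next x).opp` are its two copies.
  have h2 : ∑ x with K.orEdge x = v, (eFace x.opp : J2 N) + ∑ x with K.orEdge x = v, eFace x.bwd.opp
      = K.F (∑ x with K.orEdge x = v, Finsupp.single (Sum.inr (K.face x.bwd.opp)) 1) := by
    rw [map_sum]
    simp only [F_single_face]
    rw [Finset.sum_add_distrib, ← K.sum_orEdge_next v fun x => eFace x.opp, add_comm]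
    simp only [next_eq, opp_flip]
  have : K.h (∑ x with K.orEdge x = v, Finsupp.single x l) =
      (l.2 * 2) • K.F (Finsupp.single (Sum.inl v) 1) + (l.1 * 2) •
        K.F (Finsupp.single (Sum.inl (K.revEdge v)) 1) +
      l.1 • K.F (∑ x with K.orEdge x = v, Finsupp.single (Sum.inr (K.face x.bwd.opp)) 1) := by
    rw [← h1, ← h2, F_single_edge, map_sum, Finset.sum_congr rfl fun x _ => K.h_single x l]
    simp only [smul_add, Finset.sum_add_distrib, Finset.smul_sum, smul_smul, add_assoc]
  rw [this, ← map_smul, ← map_smul, ← map_smul, ← map_add, ← map_add]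
  exact ⟨_, rfl⟩

theorem h_mem_imF {z : Corner N →₀ L} (hz : z ∈ K.D.B₁ L) : K.h z ∈ K.imF := by
  classical
  obtain ⟨u, rfl⟩ := hz
  induction u using Finsupp.induction_linear with
  | zero => simp
  | add u w hu hw => rw [map_add, map_add]; exact K.imF.add_mem hu hw
  | single f l =>
    rcases f with a | v
    · refine Submodule.mem_sup_right (LinearMap.mem_ker.2 (K.Ω2_h_eq_zero_of_fwd fun x => ?_))
      have h1 := K.d₂_D_apply (Finsupp.single (Sum.inl a) l) x
      have h2 := K.d₂_D_apply (Finsupp.single (Sum.inl a) l) x.fwd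
      exact h2.trans (h1.trans (by simp)).symm
    · have : K.D.d₂ L (Finsupp.single (Sum.inr v) l) =
          ∑ x with K.orEdge x = v, Finsupp.single x l := by
        ext1 x
        rw [d₂_D_apply, Finsupp.finsetSum_apply, Finset.sum_filter, Finset.sum_eq_single x]
        · simp [Finsupp.single_apply, eq_comm]
        · intro y _ hy; simp [hy]
        · simp
      rw [this]
      exact Submodule.mem_sup_left (K.h_polygon_mem v l)

/-! ### The gluing equations of a linearized holonomy -/

open Classical in
theorem sum_orEdge_fwd_rev {A : Type*} [AddCommMonoid A] (v : K.OrEdge) (f : Corner N → A) :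
    ∑ x with K.orEdge x = v, f x.fwd.rev =
      ∑ x with K.orEdge x = v, f (K.flip x.bwd.rev.bwd) := by
  rw [← K.sum_orEdge_next v fun x => f x.fwd.rev]
  simp only [flip_rev_bwd, next_eq]

open Classical in
theorem sum_orEdge_self {A : Type*} [AddCommMonoid A] (v : K.OrEdge) (f : Corner N → A) :
    ∑ x with K.orEdge x = v, f x = ∑ x with K.orEdge x = v, f (K.flip x.bwd) := by
  rw [← K.sum_orEdge_next v f]
  simp only [next_eq]

/-- Around v the jumps of z occur on both copies of each side met; shifting the index by `next`
pairs them into coefficients of ∂z. Stating this for all chains, not just cycles, also yields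
`g_mem_B₁`. -/
theorem exists_Ω2_h_F_edge (v : K.OrEdge) : ∃ μ : (K.Side →₀ L) →ₗ[ℤ] ℤ, ∀ z : Corner N →₀ L,
    Ω2 N (K.h z) (K.F (Finsupp.single (Sum.inl v) 1)) = μ (K.D.d₁ L z) := by
  classical
  let n (s : K.Side) : (K.Side →₀ L) →ₗ[ℤ] ℤ := LinearMap.fst ℤ ℤ ℤ ∘ₗ Finsupp.lapply s
  let m (s : K.Side) : (K.Side →₀ L) →ₗ[ℤ] ℤ := LinearMap.snd ℤ ℤ ℤ ∘ₗ Finsupp.lapply s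
  -- The first sum collects the sides in the link at the i end of v and the sides in the links of
  -- the third vertices of the faces around v. The sum over the reversed edge collects those at the
  -- j end.
  refine ⟨∑ y with K.orEdge y = v, (n (K.side y.bwd) - 2 • m (K.side y.bwd)
    + n (K.side y.bwd.rev.bwd)) - ∑ y with K.orEdge y = K.revEdge v, n (K.side y.bwd), fun z => ?_⟩
  have hn (y : Corner N) : n (K.side y) (K.D.d₁ L z) =
      ((z y.fwd).1 - (z y).1) + ((z (K.flip y).fwd).1 - (z (K.flip y)).1) :=
    congrArg Prod.fst (K.d₁_D_apply_side z y)
  have hm (y : Corner N) : m (K.side y) (K.D.d₁ L z) =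
      ((z y.fwd).2 - (z y).2) + ((z (K.flip y).fwd).2 - (z (K.flip y)).2) :=
    congrArg Prod.snd (K.d₁_D_apply_side z y)
  rw [LinearMap.sub_apply, LinearMap.sum_apply, LinearMap.sum_apply, F_single_edge, map_sum]
  simp only [LinearMap.add_apply, LinearMap.sub_apply, LinearMap.smul_apply, hn, hm, Ω2_h_eEdge]
  have e1 := K.sum_orEdge_self v fun y => (z y.fwd).1 - (z y).1
  have e2 := K.sum_orEdge_self v fun y => (z y.fwd).2 - (z y).2
  have e3 := K.sum_orEdge_fwd_rev v fun y => (z y.fwd).1 - (z y).1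
  have e4 := K.sum_orEdge_self (K.revEdge v) fun y => (z y.fwd).1 - (z y).1
  have e5 := K.sum_orEdge_rev v fun y => (z y.fwd).1 - (z y).1
  have e6 := K.sum_orEdge_rev v fun y => (z y).1 - (z y.bwd).1
  simp only [Finset.sum_add_distrib, Finset.sum_sub_distrib, ← Finset.mul_sum,
    nsmul_eq_mul, Nat.cast_ofNat, fwd_bwd, mul_add, mul_sub]
    at e1 e2 e3 e4 e5 e6 ⊢
  linarith

/-- The two copies of the face contribute opposite rotations of the same three sides, so the jumps
pair up under `flip`. -/
theorem exists_Ω2_h_F_face (s : K.Face) : ∃ μ : (K.Side →₀ L) →ₗ[ℤ] ℤ, ∀ z : Corner N →₀ L,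
    Ω2 N (K.h z) (K.F (Finsupp.single (Sum.inr s) 1)) = μ (K.D.d₁ L z) := by
  obtain ⟨a, rfl⟩ : ∃ a, K.face a = s := Quot.exists_rep s
  obtain ⟨y, rfl⟩ := opp_surjective a
  let μ (s : K.Side) : (K.Side →₀ L) →ₗ[ℤ] ℤ :=
    2 • ((LinearMap.snd ℤ ℤ ℤ - LinearMap.fst ℤ ℤ ℤ) ∘ₗ Finsupp.lapply s)
  refine ⟨μ (K.side y) + μ (K.side y.rev.bwd) + μ (K.side y.fwd.rev), fun z => ?_⟩
  have hμ (y : Corner N) : μ (K.side y) (K.D.d₁ L z) =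
      2 * (((z y.fwd).2 - (z y).2) + ((z (K.flip y).fwd).2 - (z (K.flip y)).2)
      - (((z y.fwd).1 - (z y).1) + ((z (K.flip y).fwd).1 - (z (K.flip y)).1))) := by
    simp only [μ, LinearMap.smul_apply, LinearMap.comp_apply, LinearMap.sub_apply,
      Finsupp.lapply_apply, LinearMap.fst_apply, LinearMap.snd_apply, nsmul_eq_mul, Nat.cast_ofNat]
    rw [K.d₁_D_apply_side z y]
    rfl
  rw [F_single_face, map_add, ← opp_flip, LinearMap.add_apply, LinearMap.add_apply, hμ, hμ, hμ,
    Ω2_h_eFace, Ω2_h_eFace]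
  simp only [flip_rev_bwd, flip_fwd_rev, fwd_bwd]
  ring

theorem exists_Ω2_h_F (b : (K.OrEdge ⊕ K.Face) →₀ ℤ) :
    ∃ μ : (K.Side →₀ L) →ₗ[ℤ] ℤ, ∀ z : Corner N →₀ L,
      Ω2 N (K.h z) (K.F b) = μ (K.D.d₁ L z) := by
  induction b using Finsupp.induction_linear with
  | zero => exact ⟨0, by simp⟩
  | add b c hb hc =>
    obtain ⟨μ, hμ⟩ := hb
    obtain ⟨ν, hν⟩ := hc
    exact ⟨μ + ν, fun z => by rw [map_add, map_add, hμ, hν]; rfl⟩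
  | single f c =>
    rw [← mul_one c, ← smul_eq_mul, ← Finsupp.smul_single]
    obtain ⟨μ, hμ⟩ : ∃ μ : (K.Side →₀ L) →ₗ[ℤ] ℤ, ∀ z : Corner N →₀ L,
        Ω2 N (K.h z) (K.F (Finsupp.single f 1)) = μ (K.D.d₁ L z) := by
      rcases f with v | s
      exacts [K.exists_Ω2_h_F_edge v, K.exists_Ω2_h_F_face s]
    exact ⟨c • μ, fun z => by rw [map_smul, map_smul, hμ]; rfl⟩

theorem mem_kerFp_iff (e : J2 N) : e ∈ K.kerFp ↔ ∀ b, Ω2 N e (K.F b) = 0 :=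
  ⟨fun h b => LinearMap.congr_fun (LinearMap.mem_ker.1 h) b,
    fun h => LinearMap.mem_ker.2 (LinearMap.ext h)⟩

/-- Im F is orthogonal by the definition of `kerFp`, and Ker p by skew-symmetry. This lets Ω²
descend and sends the image of `kerFp` under g to cycles. -/
theorem Ω2_eq_zero_of_mem {e b : J2 N} (he : e ∈ K.kerFp) (hb : b ∈ K.imF) : Ω2 N e b = 0 := by
  obtain ⟨_, ⟨c, rfl⟩, w, hw, rfl⟩ := Submodule.mem_sup.1 hb
  rw [map_add, (K.mem_kerFp_iff e).1 he, Ω2_skew e w, LinearMap.mem_ker.1 hw]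
  simp

theorem h_mem_kerFp {z : Corner N →₀ L} (hz : z ∈ K.D.Z₁ L) : K.h z ∈ K.kerFp := by
  rw [mem_kerFp_iff]
  intro b
  obtain ⟨μ, hμ⟩ := K.exists_Ω2_h_F b
  rw [hμ, LinearMap.mem_ker.1 hz, map_zero]

/-! ### The dual map and the intersection pairing -/

theorem g_apply (e : J2 N) (x : Corner N) (l : L) :
    K.g e x l = Ω2 N e (K.h (Finsupp.single x l)) := by
  classical
  rw [g, LinearMap.comp_apply, LinearMap.sum_apply, Finsupp.finsetSum_apply,
    Finset.sum_eq_single x]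
  · simp
  · intro y _ hy; simp [hy]
  · simp

theorem ω_single (x : Corner N) (l : L) (w : Corner N →₀ L') :
    K.ω (Finsupp.single x l) w = w x l := by
  rw [ω, Finsupp.lsum_single]; rfl

theorem ω_g (c : Corner N →₀ L) (e : J2 N) : K.ω c (K.g e) = Ω2 N e (K.h c) := by
  induction c using Finsupp.induction_linear with
  | zero => simp
  | add c d hc hd => simp only [map_add, LinearMap.add_apply, hc, hd]
  | single x l => rw [ω_single, g_apply]

theorem ω_eq_sum (c : Corner N →₀ L) (w : Corner N →₀ L') : K.ω c w = ∑ x, w x (c x) := by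
  classical
  induction c using Finsupp.induction_linear with
  | zero => simp
  | add c d hc hd => simp [hc, hd, Finset.sum_add_distrib]
  | single x l =>
    rw [ω_single, Finset.sum_eq_single x]
    · simp
    · intro y _ hy; simp [hy.symm]
    · simp

open Classical in
theorem ω_polygon (v : K.OrEdge) (l : L) (w : Corner N →₀ L') :
    K.ω (K.D.d₂ L (Finsupp.single (Sum.inr v) l)) w =
      (∑ x with K.orEdge x = v, w x : L') l := by
  rw [ω_eq_sum, LinearMap.sum_apply, Finset.sum_filter]
  refine Finset.sum_congr rfl fun x _ => ?_
  rw [d₂_D_apply, Finsupp.single_apply, Finsupp.single_apply, if_neg (by simp), zero_add]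
  simp only [Sum.inr.injEq, eq_comm (a := v)]
  split_ifs <;> simp

theorem ω_triangle (a : Fin N × Fin 4) (l : L) (w : Corner N →₀ L') :
    K.ω (K.D.d₂ L (Finsupp.single (Sum.inl a) l)) w =
      (∑ x : Corner N with x.tri = a, w x : L') l := by
  classical
  rw [ω_eq_sum, LinearMap.sum_apply, Finset.sum_filter]
  refine Finset.sum_congr rfl fun x _ => ?_
  rw [d₂_D_apply, Finsupp.single_apply, Finsupp.single_apply, if_neg (c := _ = Sum.inr _) (by simp),
    add_zero]
  simp only [Sum.inl.injEq, eq_comm (a := a)]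
  split_ifs <;> simp

/-- The cycles of `𝒟'` are the chains orthogonal to the boundaries of `𝒟`. -/
theorem mem_Z₁_D'_iff_ω (w : Corner N →₀ L') :
    w ∈ K.D'.Z₁ L' ↔ ∀ u, K.ω (K.D.d₂ L u) w = 0 := by
  classical
  rw [mem_Z₁_D'_iff]
  constructor
  · rintro ⟨h1, h2⟩ u
    induction u using Finsupp.induction_linear with
    | zero => simp
    | add u u' h h' => simp only [map_add, LinearMap.add_apply, h, h', add_zero]
    | single f l =>
      rcases f with a | v
      · rw [ω_triangle, h2, LinearMap.zero_apply]
      · rw [ω_polygon, h1, LinearMap.zero_apply]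
  · intro h
    refine ⟨fun v => LinearMap.ext fun l => ?_, fun a => LinearMap.ext fun l => ?_⟩
    · rw [← ω_polygon, h]; rfl
    · rw [← ω_triangle, h]; rfl

theorem ω_eq_zero_of_mem_B₁ {z : Corner N →₀ L} (hz : z ∈ K.D.Z₁ L) {w : Corner N →₀ L'}
    (hw : w ∈ K.D'.B₁ L') : K.ω z w = 0 := by
  obtain ⟨u, rfl⟩ := hw
  -- Under ω the boundary of 𝒟' is adjoint to the boundary of 𝒟.
  have key : ∀ c : Corner N →₀ L, K.ω c (K.D'.d₂ L' u) =
      Finsupp.lsum ℤ (fun s => u s) (K.D.d₁ L c) := by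
    intro c
    induction c using Finsupp.induction_linear with
    | zero => simp
    | add c d hc hd => simp only [map_add, LinearMap.add_apply, hc, hd]
    | single x l =>
      rw [ω_single, d₂_D'_apply, CellComplex.d₁_single, map_sub]
      simp
  rw [key, LinearMap.mem_ker.1 hz, map_zero]

theorem g_mem_Z₁ {e : J2 N} (he : e ∈ K.kerFp) : K.g e ∈ K.D'.Z₁ L' := by
  rw [mem_Z₁_D'_iff_ω]
  intro u
  rw [ω_g]
  exact K.Ω2_eq_zero_of_mem he (K.h_mem_imF ⟨u, rfl⟩)

theorem g_mem_B₁ {e : J2 N} (he : e ∈ K.imF) : K.g e ∈ K.D'.B₁ L' := by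
  obtain ⟨_, ⟨b, rfl⟩, w, hw, rfl⟩ := Submodule.mem_sup.1 he
  have hw' : K.g w = 0 := Finsupp.ext fun x => LinearMap.ext fun l => by
    rw [g_apply, LinearMap.mem_ker.1 hw]; rfl
  rw [map_add, hw', add_zero]
  obtain ⟨μ, hμ⟩ := K.exists_Ω2_h_F b
  -- By skew-symmetry, g(F b) is the functional -μ ∘ ∂ on C₁(𝒟, L); evaluating -μ at each side gives
  -- the required function of the sides.
  refine K.mem_B₁_D' (fun x => - μ ∘ₗ Finsupp.lsingle (K.side x)) (fun x => by simp)
    fun x => LinearMap.ext fun l => ?_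
  rw [g_apply, Ω2_skew, hμ, CellComplex.d₁_single, map_sub]
  simp only [LinearMap.sub_apply, LinearMap.neg_apply, LinearMap.comp_apply, Finsupp.lsingle_apply]
  ring

/-! ### The composition of the two maps -/

/-- A function of the corners which, for a cycle, depends on the side only. -/
def sideSum {A : Type*} [AddCommGroup A] (z : Corner N → A) (x : Corner N) : A :=
  (z x.rev - z x.rev.bwd) - (z x.fwd.rev.fwd - z x.fwd.rev)

/-- Crossing the face swaps the two jumps in `sideSum`, and the cycle condition negates each; the
two effects cancel in their difference. -/
theorem sideSum_flip {A : Type} [AddCommGroup A] {z : Corner N →₀ A} (hz : z ∈ K.D.Z₁ A)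
    (x : Corner N) : sideSum z (K.flip x) = sideSum z x := by
  have h1 := K.mem_Z₁_D hz x.rev.bwd
  have h2 := K.mem_Z₁_D hz x.fwd.rev
  rw [flip_rev_bwd, fwd_bwd] at h1
  rw [flip_fwd_rev, fwd_bwd] at h2
  rw [sideSum, sideSum, h1, h2]
  abel

theorem killing_apply (x y : L) : killing x y =
    2 * x.1 * y.1 - x.1 * y.2 - x.2 * y.1 + 2 * x.2 * y.2 := rfl

/-- The `killing` term comes from the link containing x, and the `sideSum` terms from the links of
the other vertices of the tetrahedron. The latter have the shape of a boundary of 𝒟'. -/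
theorem g_h_apply (z : Corner N →₀ L) (x : Corner N) (l : L) :
    K.g (K.h z) x l = 2 * killing (z x.bwd - z x.fwd) l
      + 2 * (((sideSum z x.bwd).1 - (sideSum z x).1) * l.2
        + ((sideSum z x.bwd).2 - (sideSum z x).2) * l.1) := by
  rw [g_apply, h_single]
  simp only [map_add, map_smul, smul_eq_mul, Ω2_h_eEdge, Ω2_h_eFace, killing_apply, sideSum,
    rev_rev, fwd_bwd, bwd_fwd, rev_fwd_rev, rev_bwd_rev, Prod.fst_sub,
    Prod.snd_sub]
  ring

theorem g_h_sub_mem_B₁ {z z' : Corner N →₀ L} (hz : z ∈ K.D.Z₁ L)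
    (h : K.sd L z - K.sd' L z' ∈ K.overlay.B₁ L) :
    K.g (K.h z) - (4 : ℤ) • Finsupp.mapRange.linearMap killing z' ∈ K.D'.B₁ L' := by
  obtain ⟨p, q, hpq⟩ := (K.sd_sub_sd'_mem_B₁_iff z z').1 h
  -- T adds p over the two outer quadrilaterals at the side, one at each end. It is the correction
  -- that turns twice a midpoint into the sum of the two ends.
  let T : Corner N → L := fun x => p x.fwd + p (K.flip x).fwd
  have hT : ∀ x, z x.bwd - z x.fwd = z' x + z' x + (T x.bwd - T x) := fun x => by
    have h1 := (hpq x).1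
    have h2 := (hpq x.fwd).2.1
    have h3 := (hpq x.bwd).1
    have h4 := (hpq x).2.1
    have h5 := (hpq x).2.2.1
    simp only [prev, fwd_bwd] at h1 h3 h5
    simp only [T, fwd_bwd]
    rw [eq_sub_of_add_eq' h1.symm] at h2
    rw [eq_sub_of_add_eq' h4.symm] at h3
    rw [h2, h3, h5]
    abel
  have hTf : ∀ x, T (K.flip x) = T x := fun x => by
    simp only [T, flip_flip]; exact add_comm _ _
  -- The two summands are the primitives of the T term and of the `sideSum` term of `g_h_apply`;
  -- both are invariant under `flip`.
  let S : Corner N → L' := fun x => 2 • killing (T x)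
    + 2 • ((sideSum z x).1 • LinearMap.snd ℤ ℤ ℤ + (sideSum z x).2 • LinearMap.fst ℤ ℤ ℤ)
  refine K.mem_B₁_D' S (fun x => ?_) fun x => LinearMap.ext fun l => ?_
  · simp only [S, K.sideSum_flip hz, hTf]
  · rw [Finsupp.sub_apply, LinearMap.sub_apply, g_h_apply, hT]
    simp only [S, Finsupp.smul_apply, Finsupp.mapRange.linearMap_apply, Finsupp.mapRange_apply,
      LinearMap.smul_apply, LinearMap.add_apply, LinearMap.sub_apply, map_add, map_sub,
      LinearMap.fst_apply, LinearMap.snd_apply, smul_eq_mul, nsmul_eq_mul, Nat.cast_ofNat]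
    ring

theorem mapRange_mem_Z₁ {z : Corner N →₀ L} (hz : z ∈ K.D'.Z₁ L) :
    Finsupp.mapRange.linearMap killing z ∈ K.D'.Z₁ L' := by
  classical
  rw [mem_Z₁_D'_iff] at hz ⊢
  simp only [Finsupp.mapRange.linearMap_apply, Finsupp.mapRange_apply, ← map_sum, hz, map_zero,
    implies_true, and_self]

theorem mapRange_mem_B₁ {z : Corner N →₀ L} (hz : z ∈ K.D'.B₁ L) :
    Finsupp.mapRange.linearMap killing z ∈ K.D'.B₁ L' := by
  obtain ⟨u, rfl⟩ := hz
  refine K.mem_B₁_D' (fun x => killing (u (K.side x))) (fun x => by simp) fun x => ?_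
  rw [← map_sub, ← d₂_D'_apply]
  rfl

end Complex

end FlagComplex

end

/-! ### Descent to homology and the two identities -/

open FlagComplex in
theorem theorem7p1 {N : ℕ} (K : FlagComplex.Complex N)
    (hK : K.IsManifold) (hT : K.LinksAreTori) :
    -- the maps induced in homology
    ∃ (hbar : K.D.H₁ L →ₗ[ℤ] K.HJ) (gbar : K.HJ →ₗ[ℤ] K.D'.H₁ L'),
      Induces K.h hbar ∧ Induces K.g gbar ∧
    -- the pairings induced in homology
    ∃ (ωbar : K.D.H₁ L →ₗ[ℤ] K.D'.H₁ L' →ₗ[ℤ] ℤ) (Ωbar : K.HJ →ₗ[ℤ] K.HJ →ₗ[ℤ] ℤ),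
      InducesForm K.ω ωbar ∧ InducesForm (Ω2 N) Ωbar ∧
    -- the canonical identification of the two homology groups of `∂M`, and the change of coefficients
    ∃ (κ : K.D.H₁ L ≃ₗ[ℤ] K.D'.H₁ L) (incl : K.D'.H₁ L →ₗ[ℤ] K.D'.H₁ L'),
      K.IsCanonical κ ∧ Induces (Finsupp.mapRange.linearMap killing) incl ∧
      (∀ c : K.D.H₁ L, gbar (hbar c) = (4 : ℤ) • incl (κ c)) ∧
      (∀ (c : K.D.H₁ L) (e : K.HJ), ωbar c (gbar e) = Ωbar e (hbar c)) := by
  obtain ⟨hbar, hh⟩ := exists_induces K.h (fun _ => K.h_mem_kerFp) (fun _ => K.h_mem_imF)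
  obtain ⟨gbar, hg⟩ := exists_induces K.g (fun _ => K.g_mem_Z₁) (fun _ => K.g_mem_B₁)
  obtain ⟨ωbar, hω⟩ := exists_inducesForm (Z := K.D.Z₁ L) (B := K.D.B₁ L) (Z' := K.D'.Z₁ L')
    (B' := K.D'.B₁ L') K.ω
    (by rintro _ ⟨u, rfl⟩ z' hz'; exact (K.mem_Z₁_D'_iff_ω z').1 hz' u)
    (fun z hz b hb => K.ω_eq_zero_of_mem_B₁ hz hb)
  obtain ⟨Ωbar, hΩ⟩ := exists_inducesForm (Z := K.kerFp) (B := K.imF) (Z' := K.kerFp)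
    (B' := K.imF) (Ω2 N)
    (fun b hb z hz => by rw [Ω2_skew, K.Ω2_eq_zero_of_mem hz hb, neg_zero])
    (fun z hz b hb => K.Ω2_eq_zero_of_mem hz hb)
  obtain ⟨κ, hκ⟩ := K.exists_isCanonical L
  obtain ⟨incl, hincl⟩ := exists_induces (Finsupp.mapRange.linearMap killing)
    (fun _ => K.mapRange_mem_Z₁) (fun _ => K.mapRange_mem_B₁)
  refine ⟨hbar, gbar, hh, hg, ωbar, Ωbar, hω, hΩ, κ, incl, hκ, hincl, fun c => ?_, fun c e => ?_⟩
  · obtain ⟨z, rfl⟩ := cls_surjective c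
    -- A cycle z' representing κ[z] is homologous to z in the common subdivision, which is what the
    -- chain-level comparison requires.
    obtain ⟨z', hz'⟩ := cls_surjective (κ (cls _ _ z))
    have key := K.g_h_sub_mem_B₁ z.2 ((hκ z z').1 hz'.symm)
    obtain ⟨h1, h2⟩ := hh z
    obtain ⟨h3, h4⟩ := hg ⟨K.h z, h1⟩
    obtain ⟨h5, h6⟩ := hincl z'
    rw [h2, h4, ← hz', h6]
    exact cls_eq_smul_cls (Z := K.D'.Z₁ L') (B := K.D'.B₁ L') 4 ⟨_, h3⟩ ⟨_, h5⟩ key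
  · obtain ⟨z, rfl⟩ := cls_surjective c
    obtain ⟨v, rfl⟩ := cls_surjective e
    obtain ⟨h1, h2⟩ := hh z
    obtain ⟨h3, h4⟩ := hg v
    rw [h2, h4, hω, hΩ]
    exact K.ω_g z v
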